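/- Notation. Let $N\ge 1$, write $e(x)=\exp(2\pi i x)$, $L[s]=s^{\mathrm{tr}}Ls$. For $k\in\mathbb Z$ and a symmetric integral $N\times N$ matrix $L$ with even diagonal entries that is positive definite, $J_{k,L}$ denotes the space of Jacobi forms of weight $k$ and index $L$: holomorphic $\phi:\mathbb H\times\mathbb C^N\to\mathbb C$ such that $$(c\tau+d)^{-k}\,e\Big(-\frac{c\,L[z+\lambda\tau+\mu]}{2(c\tau+d)}+\frac{\tau L[\lambda]}{2}+\lambda^{\mathrm{tr}}Lz\Big)\,\phi\Big(\frac{a\tau+b}{c\tau+d},\frac{z+\lambda\tau+\mu}{c\tau+d}\Big)=\phi(\tau,z)$$ for all $\begin{pmatrix}a&b\\c&d\end{pmatrix}\in\mathrm{SL}_2(\mathbb Z)$, $\lambda,\mu\in\mathbb Z^N$, and such that $e(\tau L[\alpha]/2)\,\phi(\tau,\alpha\tau+\beta)$ is bounded as $\mathrm{Im}\,\tau\to\infty$ for all $\alpha,\beta\in\mathbb Q^N$. For an integral matrix $s$ with $N$ rows put $\phi[s](\tau,z)=\phi(\tau,sz)$; for square $s$ this is also written $\phi|U_s$. If $l$ is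 an integer and the index is scalar, $U_l$ is $\phi(\tau,z)\mapsto\phi(\tau,lz)$. Test sets. Let $\tilde s$ be an integral $N\times N$ matrix with $\det\tilde s\neq0$, and let $L$ be as above. Let $\mathcal R\subset\mathbb Z^N$ be a system of representatives of $(\mathbb Z^N/L\mathbb Z^N)/\{\pm1\}$ such that each $r\in\mathcal R$ has minimal norm $L^{-1}[r]$ in $r+L\mathbb Z^N$, put $\mathrm{neigh}(r)=\{r'\in r+L\mathbb Z^N: L^{-1}[r']=L^{-1}[r]\}$ and $\mathcal M=\bigcup_{r\in\mathcal R}\mathrm{neigh}(r)\cup\mathrm{neigh}(-r)$. Let $l>0$ be an integer with $l\mathbb Z^N\subseteq\tilde s\mathbb Z^N$. For each $r\in\mathcal R$ let $\mathcal T(r)\subset\mathbb Z^N\setminus\{0\}$ be a finite set that spans $\mathbb Z^N$ and such that, for every $s'\in\mathcal T(r)$, the vector $s=l\tilde s^{-1}s'$ has the property: if $r'\in\mathcal M$ and $s^{\mathrm{tr}}r'=s^{\mathrm{tr}}r$, then $r'=r$. A finite set of the form $$\mathcal S=\bigcup_{r\in\mathcal R}\{\,l\tilde s^{-1}s' : s'\in\mathcal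 T(r)\,\}\subset\mathbb Z^N$$ is called a test set for $(L,\tilde s)$. Theorem. Let $L$ be a symmetric, positive definite integral $N\times N$ matrix with even diagonal entries, and suppose that $L=L'[\tilde s]$ with integral $N\times N$ matrices $\tilde s$ and $L'$, where $L'$ has even diagonal entries. Then there is a test set for $(L,\tilde s)$, and every test set $\mathcal S$ has the following property. For $s\in\mathcal S$ let $l_s$ be the greatest common divisor of the entries of $\tilde s s$. For every $k\in\mathbb Z$ and every $0\neq\phi\in J_{k,L}$: if $\phi[s]\in J_{k,L[s]/l_s^2}\,|\,U_{l_s}$ for all $s\in\mathcal S$, then $\phi\in J_{k,L'}\,|\,U_{\tilde s}$. -/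

import Mathlib

open scoped UpperHalfPlane MatrixGroups

noncomputable section

/-- `e(x) = exp(2 π i x)`. -/
def expTwoPiI (x : ℂ) : ℂ := Complex.exp (2 * Real.pi * Complex.I * x)

/-- `L[s] = sᵗ L s` for integral matrices of compatible size. -/
def gramPullback {N M : ℕ} (L : Matrix (Fin N) (Fin N) ℤ) (s : Matrix (Fin N) (Fin M) ℤ) :
    Matrix (Fin M) (Fin M) ℤ :=
  s.transpose * L * s

/-- The complex bilinear form `xᵗ L y` attached to an integral matrix `L`. -/
def bilin {N : ℕ} (L : Matrix (Fin N) (Fin N) ℤ) (x y : Fin N → ℂ) : ℂ :=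
  dotProduct x ((L.map (Int.cast : ℤ → ℂ)).mulVec y)

/-- `L` is the Gram matrix of an even positive definite lattice: symmetric, integral, with even
diagonal entries, positive definite. -/
structure IsJacobiIndex {N : ℕ} (L : Matrix (Fin N) (Fin N) ℤ) : Prop where
  symm : L.IsSymm
  even : ∀ i, Even (L i i)
  posDef : (L.map (Int.cast : ℤ → ℝ)).PosDef

/-- The weight `k`, index `L` slash action of `(γ, (lam, mu))` in the full Jacobi group. -/
def jacobiSlash {N : ℕ} (k : ℤ) (L : Matrix (Fin N) (Fin N) ℤ) (φ : ℍ × (Fin N → ℂ) → ℂ)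
    (γ : SL(2, ℤ)) (lam mu : Fin N → ℤ) (p : ℍ × (Fin N → ℂ)) : ℂ :=
  let τ : ℂ := p.1
  let z : Fin N → ℂ := p.2
  let c : ℂ := (γ 1 0 : ℤ)
  let d : ℂ := (γ 1 1 : ℤ)
  let l : Fin N → ℂ := fun i => lam i
  let w : Fin N → ℂ := fun i => z i + lam i * τ + mu i
  (c * τ + d) ^ (-k) *
    expTwoPiI (-c * bilin L w w / (2 * (c * τ + d)) + τ * bilin L l l / 2 + bilin L l z) *
    φ (γ • p.1, fun i => w i / (c * τ + d))

/-- `φ` is a (holomorphic) Jacobi form of weight `k` and index `L`.  The growth condition says that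
`φ |_L (α, β)`, evaluated at `z = 0`, stays bounded as `Im τ → ∞`, for all rational `α`, `β`. -/
structure IsJacobiForm {N : ℕ} (k : ℤ) (L : Matrix (Fin N) (Fin N) ℤ)
    (φ : ℍ × (Fin N → ℂ) → ℂ) : Prop where
  holo : DifferentiableOn ℂ
    (fun p : ℂ × (Fin N → ℂ) => φ (UpperHalfPlane.ofComplex p.1, p.2)) {p | 0 < p.1.im}
  slash_eq : ∀ (γ : SL(2, ℤ)) (lam mu : Fin N → ℤ), jacobiSlash k L φ γ lam mu = φ
  growth : ∀ α β : Fin N → ℚ, UpperHalfPlane.IsBoundedAtImInfty fun τ : ℍ =>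
    expTwoPiI ((τ : ℂ) * bilin L (fun i => (α i : ℂ)) (fun i => (α i : ℂ)) / 2) *
      φ (τ, fun i => (α i : ℂ) * (τ : ℂ) + (β i : ℂ))

/-- The space `J_{k,L}`. -/
def jacobiForms {N : ℕ} (k : ℤ) (L : Matrix (Fin N) (Fin N) ℤ) : Set (ℍ × (Fin N → ℂ) → ℂ) :=
  {φ | IsJacobiForm k L φ}

/-- The pullback `φ[s](τ, z) = φ(τ, s z)`.  For square `s` this is the operator `U_s`. -/
def jacobiPullback {N M : ℕ} (φ : ℍ × (Fin N → ℂ) → ℂ) (s : Matrix (Fin N) (Fin M) ℤ) :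
    ℍ × (Fin M → ℂ) → ℂ :=
  fun p => φ (p.1, (s.map (Int.cast : ℤ → ℂ)).mulVec p.2)

/-- The space `J_{k,L} | U_s`. -/
def jacobiFormsU {N : ℕ} (k : ℤ) (L s : Matrix (Fin N) (Fin N) ℤ) :
    Set (ℍ × (Fin N → ℂ) → ℂ) :=
  (fun φ => jacobiPullback φ s) '' jacobiForms k L

/-- A vector of `ℤ^N` as an `N × 1` matrix. -/
def colVec {N : ℕ} (s : Fin N → ℤ) : Matrix (Fin N) (Fin 1) ℤ := Matrix.of fun i _ => s i

/-- `l_s`, the nonnegative greatest common divisor of the entries of `st * s`. -/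
def contentOf {N : ℕ} (st : Matrix (Fin N) (Fin N) ℤ) (s : Fin N → ℤ) : ℤ :=
  Finset.univ.gcd (st.mulVec s)

/-- The scalar index `L[s] / l_s²`, as a `1 × 1` matrix.  The division is exact if `L = L'[st]`,
see `contentOf_sq_mul_scalarIndex`. -/
def scalarIndex {N : ℕ} (L st : Matrix (Fin N) (Fin N) ℤ) (s : Fin N → ℤ) :
    Matrix (Fin 1) (Fin 1) ℤ :=
  !![gramPullback L (colVec s) 0 0 / contentOf st s ^ 2]

/-- The norm `L⁻¹[r]` on `ℤ^N`, viewed as the dual of the lattice with Gram matrix `L`. -/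
def dualNorm {N : ℕ} (L : Matrix (Fin N) (Fin N) ℤ) (r : Fin N → ℤ) : ℚ :=
  dotProduct (fun i => (r i : ℚ)) ((L.map (Int.cast : ℤ → ℚ))⁻¹.mulVec fun i => (r i : ℚ))

/-- `R` is a system of representatives of `(ℤ^N / L ℤ^N) / {±1}` whose elements `r` have minimal
norm in `r + L ℤ^N`. -/
structure IsMinimalRepSystem {N : ℕ} (L : Matrix (Fin N) (Fin N) ℤ)
    (R : Finset (Fin N → ℤ)) : Prop where
  existsUnique : ∀ v : Fin N → ℤ, ∃! r, r ∈ R ∧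
    ∃ lam : Fin N → ℤ, v = r + L.mulVec lam ∨ v = -r + L.mulVec lam
  minimal : ∀ r ∈ R, ∀ lam : Fin N → ℤ, dualNorm L r ≤ dualNorm L (r + L.mulVec lam)

/-- `neigh(r)`: the vectors in `r + L ℤ^N` of the same norm as `r`. -/
def neigh {N : ℕ} (L : Matrix (Fin N) (Fin N) ℤ) (r : Fin N → ℤ) : Set (Fin N → ℤ) :=
  {r' | (∃ lam : Fin N → ℤ, r' = r + L.mulVec lam) ∧ dualNorm L r' = dualNorm L r}

/-- `T` is a strong set of restriction vectors at `r`: it consists of nonzero vectors, spans `ℤ^N`,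
and for every `s'` in `T` the vector `s = l st⁻¹ s'` separates `r` from all other elements of
`neigh(r₀) ∪ neigh(-r₀)`, `r₀` in `R`. -/
structure IsStrongRestrictionSet {N : ℕ} (L st : Matrix (Fin N) (Fin N) ℤ) (l : ℤ)
    (R : Finset (Fin N → ℤ)) (r : Fin N → ℤ) (T : Finset (Fin N → ℤ)) : Prop where
  ne_zero : ∀ s' ∈ T, s' ≠ 0
  span_eq_top : Submodule.span ℤ (T : Set (Fin N → ℤ)) = ⊤
  separates : ∀ s' ∈ T, ∀ s : Fin N → ℤ, st.mulVec s = l • s' →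
    ∀ r₀ ∈ R, ∀ r' ∈ neigh L r₀ ∪ neigh L (-r₀), dotProduct s r = dotProduct s r' → r = r'

/-- `S = ⋃_{r ∈ R} { l st⁻¹ s' : s' ∈ T(r) }` for some positive `l` with `l ℤ^N ⊆ st ℤ^N`, some
system `R` of minimal representatives and some strong sets of restriction vectors `T(r)`. -/
def IsOldformTestSet {N : ℕ} (L st : Matrix (Fin N) (Fin N) ℤ) (S : Finset (Fin N → ℤ)) : Prop :=
  ∃ (l : ℤ) (R : Finset (Fin N → ℤ)) (T : (Fin N → ℤ) → Finset (Fin N → ℤ)),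
    0 < l ∧ (∀ v : Fin N → ℤ, ∃ w : Fin N → ℤ, st.mulVec w = l • v) ∧
    IsMinimalRepSystem L R ∧
    (∀ r ∈ R, IsStrongRestrictionSet L st l R r (T r)) ∧
    ∀ s : Fin N → ℤ, s ∈ S ↔ ∃ r ∈ R, ∃ s' ∈ T r, st.mulVec s = l • s'

/-- The numbers `l_s` are nonzero on the sets above. -/
theorem IsOldformTestSet.contentOf_ne_zero {N : ℕ} {L st : Matrix (Fin N) (Fin N) ℤ}
    {S : Finset (Fin N → ℤ)} (hS : IsOldformTestSet L st S) {s : Fin N → ℤ} (hs : s ∈ S) :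
    contentOf st s ≠ 0 := by
  obtain ⟨l, R, T, hl, -, -, hT, hmem⟩ := hS
  obtain ⟨r, hr, s', hs', h⟩ := (hmem s).1 hs
  intro h0
  apply (hT r hr).ne_zero s' hs'
  rw [contentOf, Finset.gcd_eq_zero_iff] at h0
  funext i
  have hi := h0 i (Finset.mem_univ i)
  rw [h] at hi
  simpa [hl.ne'] using hi

/-- The division in `scalarIndex` is exact. -/
theorem contentOf_sq_mul_scalarIndex {N : ℕ} (L' st : Matrix (Fin N) (Fin N) ℤ)
    (s : Fin N → ℤ) :
    contentOf st s ^ 2 * scalarIndex (gramPullback L' st) st s 0 0 =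
      gramPullback (gramPullback L' st) (colVec s) 0 0 := by
  have hdvd : contentOf st s ^ 2 ∣ gramPullback (gramPullback L' st) (colVec s) 0 0 := by
    have h1 : gramPullback (gramPullback L' st) (colVec s) 0 0 =
        ∑ j, (∑ i, st.mulVec s i * L' i j) * st.mulVec s j := by
      have h2 : gramPullback (gramPullback L' st) (colVec s) =
          (st * colVec s).transpose * L' * (st * colVec s) := by
        simp only [gramPullback, Matrix.transpose_mul, Matrix.mul_assoc]
      rw [h2]
      rfl
    rw [h1]
    refine Finset.dvd_sum fun j _ => ?_
    rw [pow_two]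
    refine mul_dvd_mul (Finset.dvd_sum fun i _ => ?_) (Finset.gcd_dvd (Finset.mem_univ j))
    exact Dvd.dvd.mul_right (Finset.gcd_dvd (Finset.mem_univ i)) _
  simpa [scalarIndex] using Int.mul_ediv_cancel' hdvd

end

open MeasureTheory

/-! Write c(n,r) for the Fourier coefficients of φ, and call r good if it pairs integrally with the
lattice st⁻¹ℤ^N (`PairsIntegrally`), bad otherwise. If c(n,r) = 0 for all bad r, then φ is invariant
under z ↦ z + st⁻¹m (`apply_add_of_pairsIntegrally`). Conjugating this periodicity by the inversion
S gives the elliptic law along τ·st⁻¹ℤ^N, so φ(τ, st⁻¹z) is a Jacobi form of index L'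
(`mem_jacobiFormsU`).

The vanishing is a minimal-counterexample argument
(`jacobiFourierCoeff_eq_zero_of_not_pairsIntegrally`). The coefficient c(n,r) depends only on n -
L⁻¹[r]/2 and r mod Lℤ^N, and it vanishes for n < 0; badness also depends only on r mod Lℤ^N. Take
the least n with c(n,r) ≠ 0 for some bad r. Every such r has minimal norm in its class, since
otherwise a shorter representative would occur with smaller n. By the symmetry r ↦ -r some bad r₀ in
R occurs. As T(r₀) spans ℤ^N, some s in the test set satisfies l ∤ sᵗr₀, hence l_s ∤ sᵗr₀.

The n-th coefficient of φ[s] is the exponential sum Σ c(n,r) e(sᵗr x), and by hypothesis it has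
period 1/l_s. Comparing terms of frequency sᵗr₀: no good r contributes, because l_s divides sᵗr for
good r; no other bad r contributes, because s separates r₀ from the minimal vectors. So c(n,r₀) = 0,
a contradiction.

Test sets exist because finitely many hyperplanes can be avoided by a finite spanning set of ℤ^N. -/

/-! ### The character e(x) and integral pairings. -/

theorem expTwoPiI_add (x y : ℂ) : expTwoPiI (x + y) = expTwoPiI x * expTwoPiI y := by
  simp only [expTwoPiI, ← Complex.exp_add]
  ring_nf

theorem expTwoPiI_zero : expTwoPiI 0 = 1 := by simp [expTwoPiI]

theorem expTwoPiI_intCast (n : ℤ) : expTwoPiI n = 1 := by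
  rw [expTwoPiI, Complex.exp_eq_one_iff]
  exact ⟨n, by ring⟩

theorem expTwoPiI_add_intCast (x : ℂ) (n : ℤ) : expTwoPiI (x + n) = expTwoPiI x := by
  rw [expTwoPiI_add, expTwoPiI_intCast, mul_one]

theorem expTwoPiI_ne_zero (x : ℂ) : expTwoPiI x ≠ 0 := Complex.exp_ne_zero _

theorem continuous_expTwoPiI : Continuous expTwoPiI := by
  unfold expTwoPiI
  fun_prop

theorem differentiable_expTwoPiI : Differentiable ℂ expTwoPiI := by
  unfold expTwoPiI
  fun_prop

theorem norm_expTwoPiI (x : ℂ) : ‖expTwoPiI x‖ = Real.exp (-(2 * Real.pi * x.im)) := by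
  rw [expTwoPiI, Complex.norm_exp]
  simp

/-- The bilinear pairing of an integral vector with a complex vector. -/
def intDot {N : ℕ} (r : Fin N → ℤ) (z : Fin N → ℂ) : ℂ := ∑ i, (r i : ℂ) * z i

theorem intDot_add_right {N : ℕ} (r : Fin N → ℤ) (z w : Fin N → ℂ) :
    intDot r (z + w) = intDot r z + intDot r w := by
  simp [intDot, mul_add, Finset.sum_add_distrib]

theorem intDot_add_left {N : ℕ} (r s : Fin N → ℤ) (z : Fin N → ℂ) :
    intDot (r + s) z = intDot r z + intDot s z := by
  simp [intDot, add_mul, Finset.sum_add_distrib]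

theorem intDot_neg_left {N : ℕ} (r : Fin N → ℤ) (z : Fin N → ℂ) :
    intDot (-r) z = -intDot r z := by
  simp [intDot]

theorem intDot_neg_right {N : ℕ} (r : Fin N → ℤ) (z : Fin N → ℂ) :
    intDot r (-z) = -intDot r z := by
  simp [intDot]

theorem intDot_smul_right {N : ℕ} (r : Fin N → ℤ) (t : ℂ) (z : Fin N → ℂ) :
    intDot r (t • z) = t * intDot r z := by
  simp only [intDot, Pi.smul_apply, smul_eq_mul, Finset.mul_sum]
  exact Finset.sum_congr rfl fun i _ => by ring

theorem intDot_intCast {N : ℕ} (r m : Fin N → ℤ) :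
    intDot r (fun i => (m i : ℂ)) = ((dotProduct r m : ℤ) : ℂ) := by
  simp [intDot, dotProduct]

theorem continuous_intDot {N : ℕ} (r : Fin N → ℤ) : Continuous (intDot r) := by
  unfold intDot
  fun_prop

/-- A real vector as a complex vector. -/
def toComplexVec {N : ℕ} (u : Fin N → ℝ) : Fin N → ℂ := fun i => (u i : ℂ)

theorem continuous_toComplexVec {N : ℕ} : Continuous (toComplexVec (N := N)) := by
  unfold toComplexVec
  fun_prop

theorem toComplexVec_add {N : ℕ} (u v : Fin N → ℝ) :
    toComplexVec (u + v) = toComplexVec u + toComplexVec v := by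
  ext i; simp [toComplexVec]

theorem toComplexVec_neg {N : ℕ} (u : Fin N → ℝ) : toComplexVec (-u) = -toComplexVec u := by
  ext i; simp [toComplexVec]

theorem toComplexVec_intCast {N : ℕ} (m : Fin N → ℤ) :
    toComplexVec (fun i => (m i : ℝ)) = fun i => (m i : ℂ) := by
  ext i; simp [toComplexVec]

/-! ### Fourier analysis of `ℤ^N`-periodic functions on `ℝ^N` -/

/-- Periodicity with respect to `ℤ^N`. -/
def IntPeriodic {N : ℕ} (f : (Fin N → ℝ) → ℂ) : Prop :=
  ∀ (u : Fin N → ℝ) (m : Fin N → ℤ), f (u + fun i => (m i : ℝ)) = f u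

/-- The probability Haar measure on the torus. -/
noncomputable def torusMeasure (N : ℕ) : Measure (UnitAddTorus (Fin N)) :=
  Measure.pi fun _ => AddCircle.haarAddCircle

instance (N : ℕ) : IsProbabilityMeasure (torusMeasure N) := by
  unfold torusMeasure
  infer_instance

instance (N : ℕ) : (torusMeasure N).IsAddHaarMeasure := by
  unfold torusMeasure
  infer_instance

instance (N : ℕ) : (torusMeasure N).IsNegInvariant := by
  have : (AddCircle.haarAddCircle (T := 1)).IsNegInvariant := inferInstance
  unfold torusMeasure
  exact Measure.pi.isNegInvariant _

/-- The projection `ℝ^N → (ℝ / ℤ)^N`. -/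
def torusMk {N : ℕ} (u : Fin N → ℝ) : UnitAddTorus (Fin N) := fun i => (u i : UnitAddCircle)

/-- A section of the projection `ℝ^N → (ℝ / ℤ)^N`. -/
noncomputable def torusSection {N : ℕ} (x : UnitAddTorus (Fin N)) : Fin N → ℝ :=
  fun i => Quotient.out (x i)

theorem torusMk_section {N : ℕ} (x : UnitAddTorus (Fin N)) : torusMk (torusSection x) = x := by
  funext i
  exact QuotientAddGroup.out_eq' (x i)

theorem isOpenQuotientMap_torusMk {N : ℕ} : IsOpenQuotientMap (torusMk (N := N)) :=
  IsOpenQuotientMap.piMap fun _ => QuotientAddGroup.isOpenQuotientMap_mk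

theorem IntPeriodic.eq_of_torusMk_eq {N : ℕ} {f : (Fin N → ℝ) → ℂ} (hf : IntPeriodic f)
    {u v : Fin N → ℝ} (h : torusMk u = torusMk v) : f u = f v := by
  have h1 : ∀ i, ∃ m : ℤ, (m : ℝ) = u i - v i := fun i => by
    have h2 : ((u i - v i : ℝ) : UnitAddCircle) = 0 := by
      rw [AddCircle.coe_sub, sub_eq_zero]
      exact congrFun h i
    obtain ⟨m, hm⟩ := (AddCircle.coe_eq_zero_iff 1).1 h2
    exact ⟨m, by simpa using hm⟩
  choose m hm using h1
  rw [← hf v m]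
  congr 1
  ext i
  simp [hm]

theorem IntPeriodic.apply_section_torusMk {N : ℕ} {f : (Fin N → ℝ) → ℂ} (hf : IntPeriodic f)
    (u : Fin N → ℝ) : f (torusSection (torusMk u)) = f u :=
  hf.eq_of_torusMk_eq (torusMk_section _)

/-- The section itself is not continuous; the composite is, because it descends `f` along the open
quotient map `id × torusMk`. -/
theorem continuous_comp_torusSection {A : Type*} [TopologicalSpace A] {N : ℕ}
    {f : A → (Fin N → ℝ) → ℂ} (hf : Continuous fun p : A × (Fin N → ℝ) => f p.1 p.2)
    (hper : ∀ a, IntPeriodic (f a)) :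
    Continuous fun p : A × UnitAddTorus (Fin N) => f p.1 (torusSection p.2) := by
  rw [← ((IsOpenQuotientMap.id (X := A)).prodMap
    (isOpenQuotientMap_torusMk (N := N))).continuous_comp_iff]
  convert hf using 2 with p
  exact (hper _).apply_section_torusMk _

/-- The mean value of a periodic function over a period parallelotope. -/
noncomputable def torusMean {N : ℕ} (f : (Fin N → ℝ) → ℂ) : ℂ :=
  ∫ x, f (torusSection x) ∂(torusMeasure N)

theorem torusMean_add_right {N : ℕ} {f : (Fin N → ℝ) → ℂ} (hf : IntPeriodic f)
    (a : Fin N → ℝ) : torusMean (fun u => f (u + a)) = torusMean f := by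
  unfold torusMean
  rw [← integral_add_right_eq_self (μ := torusMeasure N) (fun x => f (torusSection x))
    (torusMk a)]
  congr 1
  ext x
  apply hf.eq_of_torusMk_eq
  rw [torusMk_section]
  conv_rhs => rw [← torusMk_section x]
  rfl

theorem torusMean_neg {N : ℕ} {f : (Fin N → ℝ) → ℂ} (hf : IntPeriodic f) :
    torusMean (fun u => f (-u)) = torusMean f := by
  unfold torusMean
  rw [← integral_neg_eq_self (μ := torusMeasure N) (fun x => f (torusSection x))]
  congr 1
  ext x
  apply hf.eq_of_torusMk_eq
  rw [torusMk_section]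
  conv_rhs => rw [← torusMk_section x]
  rfl

/-- Fubini: after descent to the torus the integrand is continuous on a compact product, hence
integrable. -/
theorem intervalIntegral_torusMean_swap {N : ℕ} {f : ℝ → (Fin N → ℝ) → ℂ}
    (hf : Continuous fun p : ℝ × (Fin N → ℝ) => f p.1 p.2) (hper : ∀ a, IntPeriodic (f a)) :
    ∫ x in (0 : ℝ)..1, torusMean (f x) = torusMean fun u => ∫ x in (0 : ℝ)..1, f x u := by
  unfold torusMean
  refine intervalIntegral_integral_swap ?_
  have hc := continuous_comp_torusSection hf hper
  have h1 : IntegrableOn (Function.uncurry fun (x : ℝ) (y : UnitAddTorus (Fin N)) =>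
      f x (torusSection y)) (Set.Icc (0 : ℝ) 1 ×ˢ Set.univ) (volume.prod (torusMeasure N)) :=
    ContinuousOn.integrableOn_compact (isCompact_Icc.prod isCompact_univ) hc.continuousOn
  rw [IntegrableOn, ← Measure.prod_restrict, Measure.restrict_univ] at h1
  refine h1.mono_measure (Measure.prod_mono ?_ le_rfl)
  rw [Set.uIoc_of_le zero_le_one]
  exact Measure.restrict_mono Set.Ioc_subset_Icc_self le_rfl

/-- Finite support makes the Fourier coefficients summable, and then the Fourier series of a
continuous function converges to it pointwise. -/
theorem IntPeriodic.eq_sum_of_finite_support {N : ℕ} {f : (Fin N → ℝ) → ℂ} (hf : Continuous f)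
    (hper : IntPeriodic f) (B : Finset (Fin N → ℤ))
    (hB : ∀ r ∉ B, torusMean (fun u => f u * expTwoPiI (-intDot r (toComplexVec u))) = 0)
    (u : Fin N → ℝ) :
    f u = ∑ r ∈ B, torusMean (fun u => f u * expTwoPiI (-intDot r (toComplexVec u))) *
      expTwoPiI (intDot r (toComplexVec u)) := by
  have hF : ∀ (r : Fin N → ℤ) (u : Fin N → ℝ), UnitAddTorus.mFourier r (torusMk u) =
      expTwoPiI (intDot r (toComplexVec u)) := by
    intro r u
    simp only [UnitAddTorus.mFourier, ContinuousMap.coe_mk, torusMk, fourier_coe_apply]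
    rw [← Complex.exp_sum, expTwoPiI, intDot, Finset.mul_sum]
    congr 1
    refine Finset.sum_congr rfl fun i _ => ?_
    simp [toComplexVec]
    ring
  have hc : Continuous fun x : UnitAddTorus (Fin N) => f (torusSection x) := by
    have := continuous_comp_torusSection (A := Unit) (f := fun _ => f) (by fun_prop)
      (fun _ => hper)
    exact this.comp (Continuous.prodMk continuous_const continuous_id : Continuous fun x => ((), x))
  let F : C(UnitAddTorus (Fin N), ℂ) := ⟨_, hc⟩
  have hcoef : ∀ r, UnitAddTorus.mFourierCoeff F r =
      torusMean (fun u => f u * expTwoPiI (-intDot r (toComplexVec u))) := by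
    intro r
    change ∫ x, UnitAddTorus.mFourier (-r) x • f (torusSection x) ∂(torusMeasure N) = _
    unfold torusMean
    congr 1
    ext x
    simp only
    rw [smul_eq_mul, mul_comm, ← intDot_neg_left, ← hF, torusMk_section]
  have hs := UnitAddTorus.hasSum_mFourier_series_apply_of_summable (f := F)
    (summable_of_hasFiniteSupport (B.finite_toSet.subset fun r hr => by
      by_contra h
      exact hr ((hcoef r).trans (hB r h)))) (torusMk u)
  have h2 := hs.unique (hasSum_sum_of_ne_finset_zero (s := B) fun r hr => by
    rw [hcoef, hB r hr, zero_smul])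
  rw [← hper.apply_section_torusMk u]
  refine h2.trans (Finset.sum_congr rfl fun r _ => ?_)
  rw [hcoef, hF, smul_eq_mul]

theorem eq_zero_of_fourier_integrals_eq_zero {f : ℝ → ℂ} (hf : Continuous f)
    (hper : Function.Periodic f 1)
    (h : ∀ n : ℤ, ∫ x in (0 : ℝ)..1, f x * expTwoPiI (-n * x) = 0) (x : ℝ) : f x = 0 := by
  have hc : Continuous (hper.lift : UnitAddCircle → ℂ) := by
    rw [← (QuotientAddGroup.isOpenQuotientMap_mk
      (N := AddSubgroup.zmultiples (1 : ℝ))).continuous_comp_iff]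
    exact hf
  let F : C(UnitAddCircle, ℂ) := ⟨_, hc⟩
  have hcoef : ∀ n, fourierCoeff F n = 0 := by
    intro n
    rw [fourierCoeff_eq_intervalIntegral F n 0]
    have := h n
    rw [zero_add, ← this, one_div, inv_one, one_smul]
    congr 1
    ext x
    have : F (x : UnitAddCircle) = f x := hper.lift_coe x
    rw [this, fourier_coe_apply, smul_eq_mul, mul_comm, expTwoPiI]
    congr 2
    push_cast
    ring
  have hs := has_pointwise_sum_fourier_series_of_summable (f := F)
    (by simp [funext hcoef]) (x : UnitAddCircle)
  simp only [hcoef, zero_smul] at hs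
  exact (hper.lift_coe x).symm.trans (hs.unique hasSum_zero)

/-! ### Contour shifts in one and several variables. -/

/-- The mean value of a holomorphic periodic function over a horizontal segment of length `1` does
not depend on the height. -/
theorem intervalIntegral_horizontal_eq {f : ℂ → ℂ} {y₁ y₂ : ℝ}
    (hf : DifferentiableOn ℂ f (Complex.im ⁻¹' Set.uIcc y₁ y₂))
    (hper : ∀ z : ℂ, z.im ∈ Set.uIcc y₁ y₂ → f (z + 1) = f z) :
    ∫ x in (0 : ℝ)..1, f (x + y₁ * Complex.I) = ∫ x in (0 : ℝ)..1, f (x + y₂ * Complex.I) := by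
  have h := Complex.integral_boundary_rect_eq_zero_of_differentiableOn f (y₁ * Complex.I)
    (1 + y₂ * Complex.I) (hf.mono fun z hz => by
      have := (Complex.mem_reProdIm.1 hz).2
      simpa using this)
  have hv : ∫ y in y₁..y₂, f (1 + y * Complex.I) = ∫ y in y₁..y₂, f (y * Complex.I) := by
    refine intervalIntegral.integral_congr fun y hy => ?_
    rw [add_comm]
    exact hper _ (by simpa using hy)
  simp only [Complex.mul_re, Complex.ofReal_re, Complex.I_re, mul_zero, Complex.ofReal_im,
    Complex.I_im, mul_one, sub_self, Complex.add_re, Complex.one_re, add_zero, Complex.mul_im,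
    Complex.add_im, Complex.one_im, zero_add, Complex.ofReal_one, Complex.ofReal_zero, hv] at h
  rw [add_sub_cancel_right] at h
  exact sub_eq_zero.1 h

/-- Shifting the contour in the mean value of an entire periodic function of several variables. -/
theorem torusMean_add_smul_intCast {N : ℕ} {G : (Fin N → ℂ) → ℂ} (hG : Differentiable ℂ G)
    (hper : ∀ (z : Fin N → ℂ) (m : Fin N → ℤ), G (z + fun i => (m i : ℂ)) = G z)
    (t : ℂ) (lam : Fin N → ℤ) :
    torusMean (fun u => G (toComplexVec u + t • fun i => (lam i : ℂ))) =
      torusMean (fun u => G (toComplexVec u)) := by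
  have hper' : ∀ w, IntPeriodic fun u => G (toComplexVec u + w) := fun w u m => by
    simp only
    rw [toComplexVec_add, toComplexVec_intCast, add_right_comm, hper]
  have hreal : ∀ (w : Fin N → ℂ) (s : ℝ),
      torusMean (fun u => G (toComplexVec u + (w + (s : ℂ) • fun i => (lam i : ℂ)))) =
        torusMean (fun u => G (toComplexVec u + w)) := by
    intro w s
    rw [← torusMean_add_right (hper' w) (s • fun i => (lam i : ℝ))]
    congr 1
    ext u
    congr 1
    rw [toComplexVec_add, add_right_comm, add_assoc]
    congr 2
    ext i
    simp [toComplexVec]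
  -- Real shifts do not change the mean, so one may also average over s in [0,1]. For fixed u this
  -- is a one-variable integral along the complex line in direction `lam`, whose height b can be
  -- moved to 0.
  have havg : ∀ b : ℝ, torusMean (fun u => G (toComplexVec u + ((b : ℂ) * Complex.I) •
      fun i => (lam i : ℂ))) = torusMean fun u => ∫ s in (0 : ℝ)..1,
        G (toComplexVec u + ((s : ℂ) + b * Complex.I) • fun i => (lam i : ℂ)) := by
    intro b
    rw [← intervalIntegral_torusMean_swap (f := fun (s : ℝ) u =>
      G (toComplexVec u + ((s : ℂ) + b * Complex.I) • fun i => (lam i : ℂ)))]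
    · rw [intervalIntegral.integral_congr (g := fun _ => torusMean (fun u => G (toComplexVec u +
        ((b : ℂ) * Complex.I) • fun i => (lam i : ℂ))))]
      · simp
      · intro s _
        simp only
        rw [← hreal ((b * Complex.I) • fun i => (lam i : ℂ)) s]
        congr 1
        ext u
        rw [add_comm (s : ℂ), add_smul]
    · refine hG.continuous.comp ?_
      have := continuous_toComplexVec (N := N)
      fun_prop
    · intro s
      exact hper' _
  have h0 : ∀ b : ℝ, torusMean (fun u => G (toComplexVec u + ((b : ℂ) * Complex.I) •
      fun i => (lam i : ℂ))) = torusMean fun u => G (toComplexVec u) := by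
    intro b
    have hz := havg 0
    simp only [Complex.ofReal_zero, zero_mul, zero_smul, add_zero] at hz
    rw [havg b, hz]
    congr 1
    ext u
    have := intervalIntegral_horizontal_eq (y₁ := b) (y₂ := 0)
      (f := fun s => G (toComplexVec u + s • fun i => (lam i : ℂ)))
      (Differentiable.differentiableOn (by fun_prop)) (fun s _ => by
        rw [add_smul, one_smul, ← add_assoc, hper])
    simpa using this
  conv_lhs => rw [← Complex.re_add_im t]
  rw [← h0 t.im, ← hreal ((t.im * Complex.I) • fun i => (lam i : ℂ)) t.re]
  congr 1
  ext u
  rw [add_comm (t.re : ℂ), add_smul]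

/-! ### Fourier coefficients under the parabolic part of the Jacobi group. -/

theorem bilin_intCast_left {N : ℕ} {L : Matrix (Fin N) (Fin N) ℤ} (hL : L.IsSymm)
    (lam : Fin N → ℤ) (z : Fin N → ℂ) :
    bilin L (fun i => (lam i : ℂ)) z = intDot (L.mulVec lam) z := by
  simp only [bilin, intDot, dotProduct, Matrix.mulVec, Matrix.map_apply, Finset.mul_sum,
    Int.cast_sum, Finset.sum_mul, Int.cast_mul]
  rw [Finset.sum_comm]
  refine Finset.sum_congr rfl fun i _ => Finset.sum_congr rfl fun j _ => ?_
  rw [hL.apply i j]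
  ring

theorem bilin_intCast {N : ℕ} (L : Matrix (Fin N) (Fin N) ℤ) (lam mu : Fin N → ℤ) :
    bilin L (fun i => (lam i : ℂ)) (fun i => (mu i : ℂ)) =
      ((dotProduct lam (L.mulVec mu) : ℤ) : ℂ) := by
  simp [bilin, dotProduct, Matrix.mulVec]

/-- The analytic properties of a Jacobi form with respect to the parabolic part of the Jacobi
group, as a function on `ℂ × ℂ^N`. -/
structure IsParabolicForm {N : ℕ} (k : ℤ) (L : Matrix (Fin N) (Fin N) ℤ)
    (Φ : ℂ → (Fin N → ℂ) → ℂ) : Prop where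
  holo : DifferentiableOn ℂ (fun p : ℂ × (Fin N → ℂ) => Φ p.1 p.2) {p | 0 < p.1.im}
  add_one : ∀ t z, 0 < t.im → Φ (t + 1) z = Φ t z
  elliptic : ∀ t z, 0 < t.im → ∀ lam mu : Fin N → ℤ,
    expTwoPiI (t * bilin L (fun i => (lam i : ℂ)) (fun i => (lam i : ℂ)) / 2 +
      bilin L (fun i => (lam i : ℂ)) z) * Φ t (fun i => z i + lam i * t + mu i) = Φ t z
  neg : ∀ t z, 0 < t.im → Φ t (-z) = (-1) ^ k * Φ t z
  bounded : ∀ β : Fin N → ℚ, ∃ C A : ℝ, ∀ t : ℂ, A ≤ t.im → 0 < t.im →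
    ‖Φ t (fun i => (β i : ℂ))‖ ≤ C

/-- The `n`-th Fourier coefficient in the first variable, computed at height `y`. -/
noncomputable def fourierJacobiCoeff {N : ℕ} (Φ : ℂ → (Fin N → ℂ) → ℂ) (y : ℝ) (n : ℤ)
    (u : Fin N → ℝ) : ℂ :=
  ∫ x in (0 : ℝ)..1, Φ (x + y * Complex.I) (toComplexVec u) *
    expTwoPiI (-n * (x + y * Complex.I))

/-- The Fourier coefficient of index `(n, r)`, computed at height `y`. -/
noncomputable def jacobiFourierCoeff {N : ℕ} (Φ : ℂ → (Fin N → ℂ) → ℂ) (y : ℝ) (n : ℤ)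
    (r : Fin N → ℤ) : ℂ :=
  torusMean fun u => fourierJacobiCoeff Φ y n u * expTwoPiI (-intDot r (toComplexVec u))

theorem im_add_mul_I (x y : ℝ) : ((x : ℂ) + y * Complex.I).im = y := by simp

theorem expTwoPiI_neg_intDot_add_intCast {N : ℕ} (r m : Fin N → ℤ) (z : Fin N → ℂ) :
    expTwoPiI (-intDot r (z + fun i => (m i : ℂ))) = expTwoPiI (-intDot r z) := by
  rw [intDot_add_right, intDot_intCast, neg_add, ← Int.cast_neg, expTwoPiI_add_intCast]

namespace IsParabolicForm

variable {N : ℕ} {k : ℤ} {L : Matrix (Fin N) (Fin N) ℤ} {Φ : ℂ → (Fin N → ℂ) → ℂ}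

theorem continuous_comp (h : IsParabolicForm k L Φ) {A : Type*} [TopologicalSpace A]
    {f : A → ℂ} {g : A → Fin N → ℂ} (hf : Continuous f) (hg : Continuous g)
    (hpos : ∀ a, 0 < (f a).im) : Continuous fun a => Φ (f a) (g a) :=
  h.holo.continuousOn.comp_continuous (hf.prodMk hg) hpos

theorem isOpen_domain : IsOpen {p : ℂ × (Fin N → ℂ) | 0 < p.1.im} :=
  isOpen_lt continuous_const (Complex.continuous_im.comp continuous_fst)

theorem differentiable_right (h : IsParabolicForm k L Φ) {t : ℂ} (ht : 0 < t.im) :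
    Differentiable ℂ (Φ t) := fun z => by
  have h1 := (h.holo (t, z) ht).differentiableAt (isOpen_domain.mem_nhds ht)
  exact DifferentiableAt.comp (f := fun z => (t, z)) z h1 (by fun_prop)

theorem differentiableOn_left (h : IsParabolicForm k L Φ) (z : Fin N → ℂ) :
    DifferentiableOn ℂ (fun t => Φ t z) {t | 0 < t.im} :=
  DifferentiableOn.comp (f := fun t => (t, z)) h.holo (by fun_prop) fun _ ht => ht

theorem add_intCast (h : IsParabolicForm k L Φ) {t : ℂ} (ht : 0 < t.im) (z : Fin N → ℂ)
    (m : Fin N → ℤ) : Φ t (z + fun i => (m i : ℂ)) = Φ t z := by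
  have := h.elliptic t z ht 0 m
  rw [← this]
  have h0 : bilin L (fun _ : Fin N => (0 : ℂ)) z = 0 := by simp [bilin, dotProduct]
  have h1 : bilin L (fun _ : Fin N => (0 : ℂ)) (fun _ : Fin N => (0 : ℂ)) = 0 := by
    simp [bilin, dotProduct]
  simp only [Pi.zero_apply, Int.cast_zero, h0, h1, mul_zero, zero_div, zero_mul,
    add_zero, expTwoPiI_zero, one_mul]
  rfl

theorem continuous_fourierJacobiCoeff (h : IsParabolicForm k L Φ) {y : ℝ} (hy : 0 < y) (n : ℤ) :
    Continuous (fourierJacobiCoeff Φ y n) := by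
  unfold fourierJacobiCoeff
  refine intervalIntegral.continuous_parametric_intervalIntegral_of_continuous' ?_ _ _
  refine Continuous.mul (h.continuous_comp (by fun_prop)
    (continuous_toComplexVec.comp continuous_fst) fun a => ?_)
    (continuous_expTwoPiI.comp (by fun_prop))
  rwa [im_add_mul_I]

theorem intPeriodic_fourierJacobiCoeff (h : IsParabolicForm k L Φ) {y : ℝ} (hy : 0 < y) (n : ℤ) :
    IntPeriodic (fourierJacobiCoeff Φ y n) := fun u m => by
  unfold fourierJacobiCoeff
  congr 1
  ext x
  rw [toComplexVec_add, toComplexVec_intCast, h.add_intCast (by rwa [im_add_mul_I])]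

/-- The exponential factor is taken at the complex point x + iy, so the integrand is holomorphic and
1-periodic and the contour height is free. -/
theorem fourierJacobiCoeff_eq_of_pos (h : IsParabolicForm k L Φ) {y₁ y₂ : ℝ} (h₁ : 0 < y₁)
    (h₂ : 0 < y₂) (n : ℤ) (u : Fin N → ℝ) :
    fourierJacobiCoeff Φ y₁ n u = fourierJacobiCoeff Φ y₂ n u := by
  have hpos : ∀ y ∈ Set.uIcc y₁ y₂, 0 < y := fun y hy =>
    lt_of_lt_of_le (lt_min h₁ h₂) hy.1
  refine intervalIntegral_horizontal_eq
    (f := fun t => Φ t (toComplexVec u) * expTwoPiI (-n * t)) ?_ ?_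
  · refine DifferentiableOn.mul ((h.differentiableOn_left _).mono fun t ht => hpos _ ht) ?_
    exact (differentiable_expTwoPiI.comp (by fun_prop)).differentiableOn
  · intro t ht
    rw [h.add_one _ _ (hpos _ ht), mul_add, mul_one, ← Int.cast_neg, expTwoPiI_add_intCast]

/-- Let the height tend to infinity: at rational points the form stays bounded while the exponential
factor decays. Continuity and density of ℚ^N give all real points. -/
theorem fourierJacobiCoeff_eq_zero_of_neg (h : IsParabolicForm k L Φ) {y : ℝ} (hy : 0 < y)
    {n : ℤ} (hn : n < 0) : fourierJacobiCoeff Φ y n = 0 := by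
  have hrat : ∀ β : Fin N → ℚ, fourierJacobiCoeff Φ y n (fun i => (β i : ℝ)) = 0 := by
    intro β
    obtain ⟨C, A, hC⟩ := h.bounded β
    have hβ : toComplexVec (fun i => (β i : ℝ)) = fun i => (β i : ℂ) := by
      ext i; simp [toComplexVec]
    have hbound : ∀ᶠ Y : ℝ in Filter.atTop, ‖fourierJacobiCoeff Φ y n (fun i => (β i : ℝ))‖ ≤
        C * Real.exp (2 * Real.pi * n * Y) := by
      filter_upwards [Filter.eventually_ge_atTop A, Filter.eventually_gt_atTop 0] with Y hA hY
      rw [h.fourierJacobiCoeff_eq_of_pos hy hY]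
      refine (intervalIntegral.norm_integral_le_of_norm_le_const
        (C := C * Real.exp (2 * Real.pi * n * Y)) fun x _ => ?_).trans (by simp)
      rw [norm_mul, norm_expTwoPiI, hβ]
      have hC' := hC (x + Y * Complex.I) (by rwa [im_add_mul_I]) (by rwa [im_add_mul_I])
      have him : (-(n : ℂ) * (x + Y * Complex.I)).im = -(n * Y) := by
        rw [← Int.cast_neg, ← Complex.ofReal_intCast, Complex.im_ofReal_mul, im_add_mul_I]
        push_cast
        ring
      rw [him]
      have : -(2 * Real.pi * -(n * Y)) = 2 * Real.pi * n * Y := by ring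
      rw [this]
      exact mul_le_mul_of_nonneg_right hC' (Real.exp_pos _).le
    have hlim : Filter.Tendsto (fun Y : ℝ => C * Real.exp (2 * Real.pi * n * Y)) Filter.atTop
        (nhds (C * 0)) := by
      refine Filter.Tendsto.const_mul _ (Real.tendsto_exp_atBot.comp ?_)
      refine Filter.Tendsto.const_mul_atTop_of_neg ?_ Filter.tendsto_id
      have : (n : ℝ) < 0 := by exact_mod_cast hn
      exact mul_neg_of_pos_of_neg (by positivity) this
    rw [mul_zero] at hlim
    exact norm_le_zero_iff.1 (ge_of_tendsto hlim hbound)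
  have hdense : DenseRange fun (β : Fin N → ℚ) (i : Fin N) => (β i : ℝ) :=
    DenseRange.piMap fun _ => Rat.denseRange_cast
  exact hdense.equalizer (h.continuous_fourierJacobiCoeff hy n) continuous_const (funext hrat)

theorem jacobiFourierCoeff_eq_zero_of_neg (h : IsParabolicForm k L Φ) {y : ℝ} (hy : 0 < y)
    {n : ℤ} (hn : n < 0) (r : Fin N → ℤ) : jacobiFourierCoeff Φ y n r = 0 := by
  simp [jacobiFourierCoeff, h.fourierJacobiCoeff_eq_zero_of_neg hy hn, torusMean]

/-- Puts the mean over u inside, so that the contour in z can be shifted at a fixed t. -/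
theorem jacobiFourierCoeff_eq_integral (h : IsParabolicForm k L Φ) {y : ℝ} (hy : 0 < y)
    (n : ℤ) (r : Fin N → ℤ) : jacobiFourierCoeff Φ y n r = ∫ x in (0 : ℝ)..1,
      torusMean fun u => Φ (x + y * Complex.I) (toComplexVec u) *
        expTwoPiI (-n * (x + y * Complex.I)) * expTwoPiI (-intDot r (toComplexVec u)) := by
  rw [intervalIntegral_torusMean_swap (f := fun (x : ℝ) u =>
    Φ (x + y * Complex.I) (toComplexVec u) *
      expTwoPiI (-n * (x + y * Complex.I)) * expTwoPiI (-intDot r (toComplexVec u)))]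
  · simp only [intervalIntegral.integral_mul_const]
    rfl
  · refine Continuous.mul (Continuous.mul (h.continuous_comp (by fun_prop)
      (continuous_toComplexVec.comp continuous_snd) fun a => ?_)
      (continuous_expTwoPiI.comp (by fun_prop))) (continuous_expTwoPiI.comp
        ((continuous_intDot r).comp (continuous_toComplexVec.comp continuous_snd)).neg)
    rwa [im_add_mul_I]
  · intro x u m
    simp only
    rw [toComplexVec_add, toComplexVec_intCast, h.add_intCast (by rwa [im_add_mul_I]),
      expTwoPiI_neg_intDot_add_intCast]

/-- Fourier coefficients depend only on `r` modulo `L ℤ^N` and on `n - L⁻¹[r] / 2`. -/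
theorem jacobiFourierCoeff_add_mulVec (h : IsParabolicForm k L Φ) (hL : L.IsSymm) {y : ℝ}
    (hy : 0 < y) (n E : ℤ) (r lam : Fin N → ℤ)
    (hE : 2 * E = 2 * dotProduct r lam + dotProduct lam (L.mulVec lam)) :
    jacobiFourierCoeff Φ y (n + E) (r + L.mulVec lam) = jacobiFourierCoeff Φ y n r := by
  rw [h.jacobiFourierCoeff_eq_integral hy, h.jacobiFourierCoeff_eq_integral hy]
  congr 1
  ext x
  set t : ℂ := x + y * Complex.I with ht
  have htpos : 0 < t.im := by rwa [ht, im_add_mul_I]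
  -- Shift the z-contour by tλ; the elliptic law then absorbs the shift. The leftover exponents in t
  -- cancel by `hE`.
  have hshift := torusMean_add_smul_intCast
    (G := fun z => Φ t z * expTwoPiI (-n * t) * expTwoPiI (-intDot r z)) (by
      refine Differentiable.mul (Differentiable.mul (h.differentiable_right htpos) (by fun_prop)) ?_
      refine differentiable_expTwoPiI.comp (Differentiable.neg ?_)
      unfold intDot
      fun_prop) (by
      intro z m
      rw [h.add_intCast htpos, expTwoPiI_neg_intDot_add_intCast]) t lam
  rw [← hshift]
  congr 1
  ext u
  set z := toComplexVec u
  have hell := h.elliptic t z htpos lam 0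
  have hz : (fun i => z i + lam i * t + ((0 : Fin N → ℤ) i : ℂ)) =
      z + t • fun i => (lam i : ℂ) := by
    ext i
    simp [mul_comm]
  rw [hz, bilin_intCast, bilin_intCast_left hL] at hell
  rw [← hell]
  have hE' : (2 : ℂ) * E = 2 * ((dotProduct r lam : ℤ) : ℂ) +
      ((dotProduct lam (L.mulVec lam) : ℤ) : ℂ) := by exact_mod_cast hE
  rw [intDot_add_right, intDot_smul_right, intDot_intCast, intDot_add_left]
  have key : ∀ {a b c d e : ℂ} (w : ℂ), a + b + c = d + e →
      expTwoPiI a * w * expTwoPiI b * expTwoPiI c = w * expTwoPiI d * expTwoPiI e := by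
    intro a b c d e w hs
    have := congrArg expTwoPiI hs
    simp only [expTwoPiI_add] at this
    linear_combination w * this
  refine key _ ?_
  push_cast
  linear_combination (-t / 2) * hE'

theorem jacobiFourierCoeff_neg (h : IsParabolicForm k L Φ) {y : ℝ} (hy : 0 < y) (n : ℤ)
    (r : Fin N → ℤ) : jacobiFourierCoeff Φ y n (-r) = (-1) ^ k * jacobiFourierCoeff Φ y n r := by
  have hF : ∀ u, fourierJacobiCoeff Φ y n (-u) = (-1) ^ k * fourierJacobiCoeff Φ y n u := by
    intro u
    unfold fourierJacobiCoeff
    rw [← intervalIntegral.integral_const_mul]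
    congr 1
    ext x
    rw [toComplexVec_neg, h.neg _ _ (by rwa [im_add_mul_I]), mul_assoc]
  have hper : IntPeriodic fun u =>
      fourierJacobiCoeff Φ y n u * expTwoPiI (-intDot (-r) (toComplexVec u)) := fun u m => by
    simp only
    rw [h.intPeriodic_fourierJacobiCoeff hy, toComplexVec_add, toComplexVec_intCast,
      expTwoPiI_neg_intDot_add_intCast]
  rw [jacobiFourierCoeff, ← torusMean_neg hper, jacobiFourierCoeff, torusMean, torusMean,
    ← integral_const_mul]
  congr 1
  ext x
  rw [hF, toComplexVec_neg, intDot_neg_left, intDot_neg_right, neg_neg, mul_assoc]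

theorem fourierJacobiCoeff_eq_sum (h : IsParabolicForm k L Φ) {y : ℝ} (hy : 0 < y) (n : ℤ)
    (B : Finset (Fin N → ℤ)) (hB : ∀ r ∉ B, jacobiFourierCoeff Φ y n r = 0) (u : Fin N → ℝ) :
    fourierJacobiCoeff Φ y n u =
      ∑ r ∈ B, jacobiFourierCoeff Φ y n r * expTwoPiI (intDot r (toComplexVec u)) :=
  (h.intPeriodic_fourierJacobiCoeff hy n).eq_sum_of_finite_support
    (h.continuous_fourierJacobiCoeff hy n) B hB u

/-- A real translation that fixes all Fourier-Jacobi coefficients fixes the form. -/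
theorem apply_add_toComplexVec (h : IsParabolicForm k L Φ) {μ : Fin N → ℝ}
    (hμ : ∀ (y : ℝ), 0 < y → ∀ (n : ℤ) (u : Fin N → ℝ),
      fourierJacobiCoeff Φ y n (u + μ) = fourierJacobiCoeff Φ y n u)
    {t : ℂ} (ht : 0 < t.im) (z : Fin N → ℂ) : Φ t (z + toComplexVec μ) = Φ t z := by
  have hreal : ∀ u : Fin N → ℝ,
      Φ t (toComplexVec u + toComplexVec μ) = Φ t (toComplexVec u) := by
    intro u
    have hpos : ∀ x : ℝ, 0 < ((x : ℂ) + t.im * Complex.I).im := fun x => by rwa [im_add_mul_I]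
    have hc : ∀ w : Fin N → ℂ, Continuous fun x : ℝ => Φ (x + t.im * Complex.I) w := fun w =>
      h.continuous_comp (by fun_prop) continuous_const hpos
    have hi : ∀ (w : Fin N → ℂ) (n : ℤ), IntervalIntegrable
        (fun x : ℝ => Φ (x + t.im * Complex.I) w * expTwoPiI (-n * (x + t.im * Complex.I)))
        volume 0 1 := fun w n =>
      ((hc w).mul (continuous_expTwoPiI.comp (by fun_prop))).intervalIntegrable _ _
    -- On the horizontal line through t the difference is 1-periodic in x, and all its Fourier
    -- integrals vanish once the nonzero constant e(-n i Im t) is split off.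
    have hzero := eq_zero_of_fourier_integrals_eq_zero
      (f := fun x : ℝ => Φ (x + t.im * Complex.I) (toComplexVec (u + μ)) -
        Φ (x + t.im * Complex.I) (toComplexVec u)) ((hc _).sub (hc _)) (fun x => by
          have hx : (((x + 1 : ℝ) : ℂ) + t.im * Complex.I) = x + t.im * Complex.I + 1 := by
            push_cast; ring
          simp only [hx]
          rw [h.add_one _ _ (hpos x), h.add_one _ _ (hpos x)]) (fun n => by
        have h1 := sub_eq_zero.2 (hμ _ ht n u)
        unfold fourierJacobiCoeff at h1
        rw [← intervalIntegral.integral_sub (hi _ n) (hi _ n)] at h1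
        have h2 : ∀ x : ℝ, expTwoPiI (-n * (x + t.im * Complex.I)) =
            expTwoPiI (-n * x) * expTwoPiI (-n * (t.im * Complex.I)) := fun x => by
          rw [mul_add, expTwoPiI_add]
        simp only [h2, ← sub_mul, ← mul_assoc] at h1
        rw [intervalIntegral.integral_mul_const] at h1
        exact (mul_eq_zero.1 h1).resolve_right (expTwoPiI_ne_zero _)) t.re
    rw [Complex.re_add_im, toComplexVec_add] at hzero
    exact sub_eq_zero.1 hzero
  let a : Fin N → ℝ := fun i => (z i).re
  let b : Fin N → ℝ := fun i => (z i).im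
  have hz : z = toComplexVec a + Complex.I • toComplexVec b := by
    ext i
    simp only [a, b, toComplexVec, Pi.add_apply, Pi.smul_apply, smul_eq_mul]
    rw [mul_comm, Complex.re_add_im]
  have hd := h.differentiable_right ht
  have hf : Differentiable ℂ fun s : ℂ =>
      Φ t (toComplexVec a + s • toComplexVec b + toComplexVec μ) := hd.comp (by fun_prop)
  have hg : Differentiable ℂ fun s : ℂ => Φ t (toComplexVec a + s • toComplexVec b) :=
    hd.comp (by fun_prop)
  -- Passage from real to complex z: on the complex line s ↦ a + s b both sides are entire and agree
  -- at the real points 1/(n+1), which accumulate at 0. The value s = i gives z.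
  have heq := AnalyticOnNhd.eq_of_frequently_eq (z₀ := (0 : ℂ))
    (fun s _ => hf.analyticAt s) (fun s _ => hg.analyticAt s) (by
      have hs : Filter.Tendsto (fun n : ℕ => ((1 / ((n : ℝ) + 1) : ℝ) : ℂ)) Filter.atTop
          (nhdsWithin 0 {0}ᶜ) := by
        refine tendsto_nhdsWithin_iff.2 ⟨?_, Filter.Eventually.of_forall fun n => ?_⟩
        · have := (Complex.continuous_ofReal.tendsto 0).comp
            (tendsto_one_div_add_atTop_nhds_zero_nat (𝕜 := ℝ))
          rwa [Complex.ofReal_zero] at this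
        · have : (1 / ((n : ℝ) + 1) : ℝ) ≠ 0 := by positivity
          simpa only [Set.mem_compl_iff, Set.mem_singleton_iff, Complex.ofReal_eq_zero] using this
      refine hs.frequently (Filter.Frequently.of_forall fun n => ?_)
      have := hreal (a + (1 / ((n : ℝ) + 1)) • b)
      have hab : ∀ s : ℝ, toComplexVec (a + s • b) =
          toComplexVec a + (s : ℂ) • toComplexVec b := fun s => by
        ext i; simp [toComplexVec]
      rwa [hab] at this)
  rw [hz]
  exact congrFun heq Complex.I

end IsParabolicForm

/-! ### Arithmetic of the form L and of its dual norm. -/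

namespace IsJacobiIndex

variable {N : ℕ} {L : Matrix (Fin N) (Fin N) ℤ}

theorem det_ne_zero (hL : IsJacobiIndex L) : L.det ≠ 0 := by
  have h := hL.posDef.det_pos
  intro h0
  have h1 : (L.map (Int.cast : ℤ → ℝ)).det = (L.det : ℝ) := ((Int.castRingHom ℝ).map_det L).symm
  rw [h1, h0] at h
  simp at h

theorem isUnit_det_ratCast (hL : IsJacobiIndex L) : IsUnit (L.map (Int.cast : ℤ → ℚ)).det := by
  have h1 : (L.map (Int.cast : ℤ → ℚ)).det = (L.det : ℚ) := ((Int.castRingHom ℚ).map_det L).symm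
  rw [h1, isUnit_iff_ne_zero]
  exact_mod_cast hL.det_ne_zero

theorem dotProduct_mulVec_pos (hL : IsJacobiIndex L) {w : Fin N → ℚ} (hw : w ≠ 0) :
    0 < dotProduct w ((L.map (Int.cast : ℤ → ℚ)).mulVec w) := by
  have hw' : (fun i => (w i : ℝ)) ≠ 0 := by
    intro h
    apply hw
    ext i
    have := congrFun h i
    simpa using this
  have h := hL.posDef.dotProduct_mulVec_pos hw'
  have h2 : (dotProduct (star fun i => (w i : ℝ))
      ((L.map (Int.cast : ℤ → ℝ)).mulVec fun i => (w i : ℝ))) =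
      ((dotProduct w ((L.map (Int.cast : ℤ → ℚ)).mulVec w) : ℚ) : ℝ) := by
    simp [dotProduct, Matrix.mulVec]
  rw [h2] at h
  exact_mod_cast h

theorem dotProduct_mulVec_nonneg (hL : IsJacobiIndex L) (w : Fin N → ℚ) :
    0 ≤ dotProduct w ((L.map (Int.cast : ℤ → ℚ)).mulVec w) := by
  rcases eq_or_ne w 0 with rfl | hw
  · simp
  · exact (hL.dotProduct_mulVec_pos hw).le

theorem isSymm_ratCast (hL : IsJacobiIndex L) : (L.map (Int.cast : ℤ → ℚ)).IsSymm := by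
  ext i j
  simp [hL.symm.apply i j]

theorem dotProduct_mulVec_comm (hL : IsJacobiIndex L) (v w : Fin N → ℚ) :
    dotProduct v ((L.map (Int.cast : ℤ → ℚ)).mulVec w) =
      dotProduct w ((L.map (Int.cast : ℤ → ℚ)).mulVec v) := by
  rw [Matrix.dotProduct_mulVec, ← Matrix.mulVec_transpose, hL.isSymm_ratCast.eq, dotProduct_comm]

theorem mulVec_inv_mulVec (hL : IsJacobiIndex L) (v : Fin N → ℚ) :
    (L.map (Int.cast : ℤ → ℚ)).mulVec ((L.map (Int.cast : ℤ → ℚ))⁻¹.mulVec v) = v := by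
  rw [Matrix.mulVec_mulVec, Matrix.mul_nonsing_inv _ hL.isUnit_det_ratCast, Matrix.one_mulVec]

theorem inv_mulVec_mulVec (hL : IsJacobiIndex L) (v : Fin N → ℚ) :
    (L.map (Int.cast : ℤ → ℚ))⁻¹.mulVec ((L.map (Int.cast : ℤ → ℚ)).mulVec v) = v := by
  rw [Matrix.mulVec_mulVec, Matrix.nonsing_inv_mul _ hL.isUnit_det_ratCast, Matrix.one_mulVec]

theorem dualNorm_add_mulVec (hL : IsJacobiIndex L) (r lam : Fin N → ℤ) :
    dualNorm L (r + L.mulVec lam) = dualNorm L r +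
      ((2 * dotProduct r lam + dotProduct lam (L.mulVec lam) : ℤ) : ℚ) := by
  set A := L.map (Int.cast : ℤ → ℚ) with hA
  set x := A⁻¹.mulVec fun i => (r i : ℚ) with hx
  have hcast : (fun i => ((r + L.mulVec lam) i : ℚ)) =
      (fun i => (r i : ℚ)) + A.mulVec fun i => (lam i : ℚ) := by
    ext i
    simp [hA, Matrix.mulVec, dotProduct]
  have hr : (fun i => (r i : ℚ)) = A.mulVec x := (hL.mulVec_inv_mulVec _).symm
  have h1 : ((dotProduct r lam : ℤ) : ℚ) =
      dotProduct (fun i => (r i : ℚ)) fun i => (lam i : ℚ) := by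
    simp [dotProduct]
  have h2 : ((dotProduct lam (L.mulVec lam) : ℤ) : ℚ) =
      dotProduct (fun i => (lam i : ℚ)) (A.mulVec fun i => (lam i : ℚ)) := by
    simp [dotProduct, hA, Matrix.mulVec]
  rw [dualNorm, dualNorm, hcast, Matrix.mulVec_add, hL.inv_mulVec_mulVec, ← hx]
  push_cast
  rw [h1, h2, add_dotProduct, dotProduct_add, dotProduct_add,
    dotProduct_comm (A.mulVec _) x, hL.dotProduct_mulVec_comm, ← hr,
    dotProduct_comm _ (fun i => (r i : ℚ)), dotProduct_comm (A.mulVec _)]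
  ring

/-- Cauchy–Schwarz for L applied to x = L⁻¹r and the basis vector e_i, since xᵗLe_i = r_i; it is
read off from positivity at L_ii x - r_i e_i. -/
theorem sq_le_dualNorm (hL : IsJacobiIndex L) (r : Fin N → ℤ) (i : Fin N) :
    ((r i : ℚ)) ^ 2 ≤ L i i * dualNorm L r := by
  set A := L.map (Int.cast : ℤ → ℚ) with hA
  set x := A⁻¹.mulVec fun i => (r i : ℚ) with hx
  have hr : A.mulVec x = fun i => (r i : ℚ) := hL.mulVec_inv_mulVec _
  have hQ : dualNorm L r = dotProduct x (A.mulVec x) := by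
    rw [hr, dotProduct_comm, dualNorm]
  have hsingle : A.mulVec (Pi.single i 1) i = L i i := by
    simp [hA]
  have hpos : (0 : ℚ) < L i i := by
    have := hL.dotProduct_mulVec_pos (w := Pi.single i 1) (by simp)
    rwa [← hA, single_dotProduct, one_mul, hsingle] at this
  have h := hL.dotProduct_mulVec_nonneg
    ((L i i : ℚ) • x - (r i : ℚ) • (Pi.single i 1 : Fin N → ℚ))
  rw [← hA] at h
  have hcross : dotProduct x (A.mulVec (Pi.single i 1)) = r i := by
    rw [hL.dotProduct_mulVec_comm, ← hA, hr, single_dotProduct, one_mul]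
  have hcross' : dotProduct (Pi.single i 1) (A.mulVec x) = (r i : ℚ) := by
    rw [hr, single_dotProduct, one_mul]
  have hii : dotProduct (Pi.single i 1) (A.mulVec (Pi.single i 1)) = (L i i : ℚ) := by
    rw [single_dotProduct, one_mul, hsingle]
  simp only [Matrix.mulVec_sub, Matrix.mulVec_smul, dotProduct_sub, sub_dotProduct,
    smul_dotProduct, dotProduct_smul, smul_eq_mul, hcross, hcross', hii, ← hQ] at h
  have h2 : 0 ≤ (L i i : ℚ) * (L i i * dualNorm L r - (r i : ℚ) ^ 2) := by
    linarith
  linarith [nonneg_of_mul_nonneg_right h2 hpos]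

theorem finite_setOf_dualNorm_le (hL : IsJacobiIndex L) (C : ℚ) :
    {r : Fin N → ℤ | dualNorm L r ≤ C}.Finite := by
  have hbox : ∀ i, ∃ b : ℤ, ∀ r : Fin N → ℤ, dualNorm L r ≤ C → |r i| ≤ b := by
    intro i
    refine ⟨⌈(|L i i| : ℚ) * |C|⌉, fun r hr => ?_⟩
    have hpos : (0 : ℚ) ≤ dualNorm L r := by
      have h := hL.dotProduct_mulVec_nonneg ((L.map (Int.cast : ℤ → ℚ))⁻¹.mulVec fun i => (r i : ℚ))
      rwa [hL.mulVec_inv_mulVec, dotProduct_comm] at h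
    have h1 : (|r i| : ℤ) ≤ (r i) ^ 2 := by
      rw [← sq_abs]
      exact Int.le_self_sq _
    have h2 : ((r i : ℚ)) ^ 2 ≤ |(L i i : ℚ)| * |C| := by
      refine (hL.sq_le_dualNorm r i).trans ?_
      exact mul_le_mul (le_abs_self _) (hr.trans (le_abs_self _)) hpos (abs_nonneg _)
    have h3 : ((|r i| : ℤ) : ℚ) ≤ (r i : ℚ) ^ 2 := by exact_mod_cast h1
    exact_mod_cast (h3.trans h2).trans (Int.le_ceil _)
  choose b hb using hbox
  refine (Set.finite_Icc (-b) b).subset fun r hr => ?_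
  exact ⟨fun i => (abs_le.1 (hb i r hr)).1, fun i => (abs_le.1 (hb i r hr)).2⟩

end IsJacobiIndex

/-! ### Minimal representatives and existence of test sets. -/

theorem dualNorm_neg {N : ℕ} (L : Matrix (Fin N) (Fin N) ℤ) (r : Fin N → ℤ) :
    dualNorm L (-r) = dualNorm L r := by
  have : (fun i => (((-r) i : ℤ) : ℚ)) = -fun i => (r i : ℚ) := by
    ext i; simp
  rw [dualNorm, this, Matrix.mulVec_neg, neg_dotProduct_neg, dualNorm]

/-- Congruence modulo `L ℤ^N` up to sign. -/
def signedCongr {N : ℕ} (L : Matrix (Fin N) (Fin N) ℤ) : Setoid (Fin N → ℤ) where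
  r v r := ∃ lam : Fin N → ℤ, v = r + L.mulVec lam ∨ v = -r + L.mulVec lam
  iseqv := by
    refine ⟨fun v => ⟨0, Or.inl (by simp)⟩, ?_, ?_⟩
    · rintro v r ⟨lam, h | h⟩
      · exact ⟨-lam, Or.inl (by rw [h, Matrix.mulVec_neg]; abel)⟩
      · exact ⟨lam, Or.inr (by rw [h]; abel)⟩
    · rintro u v r ⟨lam, h | h⟩ ⟨mu, h' | h'⟩
      · exact ⟨mu + lam, Or.inl (by rw [h, h', Matrix.mulVec_add]; abel)⟩
      · exact ⟨mu + lam, Or.inr (by rw [h, h', Matrix.mulVec_add]; abel)⟩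
      · exact ⟨-mu + lam, Or.inr (by rw [h, h', Matrix.mulVec_add, Matrix.mulVec_neg]; abel)⟩
      · exact ⟨-mu + lam, Or.inl (by rw [h, h', Matrix.mulVec_add, Matrix.mulVec_neg]; abel)⟩

/-- Residues modulo det L determine the class, because the adjugate shows det L · ℤ^N ⊆ L ℤ^N. -/
theorem finite_quotient_signedCongr {N : ℕ} {L : Matrix (Fin N) (Fin N) ℤ} (hL : L.det ≠ 0) :
    Finite (Quotient (signedCongr L)) := by
  have : NeZero L.det.natAbs := ⟨by simpa using hL⟩
  refine Finite.of_injective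
    (fun (q : Quotient (signedCongr L)) (i : Fin N) => (q.out i : ZMod L.det.natAbs)) ?_
  intro p q hpq
  rw [← p.out_eq, ← q.out_eq]
  apply Quotient.sound
  have hdvd : ∀ i, L.det ∣ p.out i - q.out i := fun i => by
    have h := (ZMod.intCast_eq_intCast_iff_dvd_sub _ _ _).1 (congrFun hpq i).symm
    exact (Int.natAbs_dvd).1 h
  choose m hm using hdvd
  refine ⟨L.adjugate.mulVec m, Or.inl ?_⟩
  rw [Matrix.mulVec_mulVec, Matrix.mul_adjugate, Matrix.smul_mulVec, Matrix.one_mulVec]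
  ext i
  simp only [Pi.add_apply, Pi.smul_apply, smul_eq_mul, ← hm]
  ring

theorem IsJacobiIndex.exists_isMinimalRepSystem {N : ℕ} {L : Matrix (Fin N) (Fin N) ℤ}
    (hL : IsJacobiIndex L) : ∃ R, IsMinimalRepSystem L R := by
  have hmin : ∀ q : Quotient (signedCongr L), ∃ r : Fin N → ℤ, Quotient.mk _ r = q ∧
      ∀ r' : Fin N → ℤ, Quotient.mk (signedCongr L) r' = q → dualNorm L r ≤ dualNorm L r' := by
    intro q
    -- Vectors longer than `q.out` are irrelevant for the minimum, and those that remain form a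
    -- finite nonempty set.
    obtain ⟨r, ⟨hr, hrq⟩, hmin⟩ := Set.exists_min_image
      ({r | dualNorm L r ≤ dualNorm L q.out} ∩ {r | Quotient.mk (signedCongr L) r = q})
      (dualNorm L) ((hL.finite_setOf_dualNorm_le _).inter_of_left _)
      ⟨q.out, le_refl (dualNorm L q.out), q.out_eq⟩
    refine ⟨r, hrq, fun r' hr' => ?_⟩
    rcases le_total (dualNorm L r') (dualNorm L q.out) with h | h
    · exact hmin r' ⟨h, hr'⟩
    · exact hr.trans h
  choose m hm hmle using hmin
  have := finite_quotient_signedCongr hL.det_ne_zero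
  have hmem : ∀ r, r ∈ (Set.finite_range m).toFinset ↔ ∃ q, m q = r := fun r => by simp
  refine ⟨(Set.finite_range m).toFinset, ⟨fun v => ?_, fun r hr lam => ?_⟩⟩
  · refine ⟨m (Quotient.mk _ v), ⟨(hmem _).2 ⟨_, rfl⟩, Quotient.exact (hm _).symm⟩, ?_⟩
    rintro r ⟨hr, hvr⟩
    obtain ⟨q, rfl⟩ := (hmem r).1 hr
    have hq : Quotient.mk (signedCongr L) v = q := (Quotient.sound hvr).trans (hm q)
    rw [hq]
  · obtain ⟨q, rfl⟩ := (hmem r).1 hr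
    refine hmle q _ ((Quotient.sound ?_).trans (hm q))
    exact ⟨lam, Or.inl rfl⟩

/-- K = 1 + Σ|b_i| exceeds every |b_i|, while |a_i| ≥ 1. -/
theorem exists_int_mul_add_ne_zero {ι : Type*} (I : Finset ι) (a b : ι → ℤ)
    (ha : ∀ i ∈ I, a i ≠ 0) : ∃ K : ℤ, ∀ i ∈ I, K * a i + b i ≠ 0 := by
  refine ⟨1 + ∑ i ∈ I, |b i|, fun i hi h => ?_⟩
  have h1 : |b i| ≤ ∑ i ∈ I, |b i| :=
    Finset.single_le_sum (f := fun i => |b i|) (fun j _ => abs_nonneg (b j)) hi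
  have h2 : 1 ≤ |a i| := Int.one_le_abs (ha i hi)
  have h3 : (1 + ∑ i ∈ I, |b i|) * |a i| = |b i| := by
    have h4 : (1 + ∑ i ∈ I, |b i|) * a i = -b i := by linarith
    have h5 := congrArg abs h4
    rwa [abs_mul, abs_neg, abs_of_nonneg (by linarith [abs_nonneg (b i)])] at h5
  nlinarith [abs_nonneg (b i)]

theorem exists_forall_dotProduct_ne_zero {N : ℕ} (D : Finset (Fin N → ℤ))
    (hD : ∀ d ∈ D, d ≠ 0) : ∃ v : Fin N → ℤ, ∀ d ∈ D, dotProduct v d ≠ 0 := by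
  classical
  induction D using Finset.induction_on with
  | empty => exact ⟨0, by simp⟩
  | insert d D _ ih =>
    obtain ⟨v, hv⟩ := ih fun d' hd' => hD d' (Finset.mem_insert_of_mem hd')
    by_cases hvd : dotProduct v d = 0
    -- Adding d to a large multiple of v makes the pairing with d equal to d·d ≠ 0 and keeps the old
    -- pairings nonzero.
    · obtain ⟨K, hK⟩ := exists_int_mul_add_ne_zero D (dotProduct v) (dotProduct d) hv
      refine ⟨K • v + d, fun d' hd' => ?_⟩
      rw [add_dotProduct, smul_dotProduct, smul_eq_mul]
      rcases Finset.mem_insert.1 hd' with rfl | h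
      · rw [hvd, mul_zero, zero_add, Ne, dotProduct_self_eq_zero]
        exact hD _ hd'
      · exact hK d' h
    · refine ⟨v, fun d' hd' => ?_⟩
      rcases Finset.mem_insert.1 hd' with rfl | h
      · exact hvd
      · exact hv d' h

/-- There are finite spanning sets of `ℤ^N` avoiding finitely many given hyperplanes. -/
theorem exists_span_eq_top_forall_dotProduct_ne_zero {N : ℕ} (hN : 0 < N)
    (D : Finset (Fin N → ℤ)) (hD : ∀ d ∈ D, d ≠ 0) :
    ∃ T : Finset (Fin N → ℤ), Submodule.span ℤ (T : Set (Fin N → ℤ)) = ⊤ ∧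
      (∀ s ∈ T, s ≠ 0) ∧ ∀ s ∈ T, ∀ d ∈ D, dotProduct s d ≠ 0 := by
  classical
  -- An auxiliary hyperplane: nonzero pairing with `d₀` forces the chosen vectors to be nonzero.
  let d₀ : Fin N → ℤ := Pi.single ⟨0, hN⟩ 1
  obtain ⟨v, hv⟩ := exists_forall_dotProduct_ne_zero (insert d₀ D) (by
    intro d hd
    rcases Finset.mem_insert.1 hd with rfl | h
    · simp [d₀]
    · exact hD d h)
  obtain ⟨K, hK⟩ := exists_int_mul_add_ne_zero (Finset.univ ×ˢ insert d₀ D)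
    (fun p : Fin N × (Fin N → ℤ) => dotProduct v p.2) (fun p => p.2 p.1)
    (fun p hp => hv _ (Finset.mem_product.1 hp).2)
  -- These span because (Kv + e_i) - Kv = e_i.
  let T : Finset (Fin N → ℤ) := insert v (Finset.univ.image fun i => K • v + Pi.single i 1)
  have hT : ∀ s ∈ T, ∀ d ∈ insert d₀ D, dotProduct s d ≠ 0 := by
    intro s hs d hd
    rcases Finset.mem_insert.1 hs with rfl | h
    · exact hv d hd
    · obtain ⟨i, -, rfl⟩ := Finset.mem_image.1 h
      rw [add_dotProduct, smul_dotProduct, single_dotProduct, one_mul, smul_eq_mul]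
      exact hK (i, d) (Finset.mem_product.2 ⟨Finset.mem_univ _, hd⟩)
  refine ⟨T, ?_, fun s hs h0 => ?_, fun s hs d hd => hT s hs d (Finset.mem_insert_of_mem hd)⟩
  · have hvT : v ∈ Submodule.span ℤ (T : Set (Fin N → ℤ)) :=
      Submodule.subset_span (Finset.mem_coe.2 (Finset.mem_insert_self _ _))
    have hei : ∀ i, (Pi.single i 1 : Fin N → ℤ) ∈ Submodule.span ℤ (T : Set (Fin N → ℤ)) := by
      intro i
      have h1 : K • v + Pi.single i 1 ∈ Submodule.span ℤ (T : Set (Fin N → ℤ)) :=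
        Submodule.subset_span (Finset.mem_coe.2 (Finset.mem_insert_of_mem
          (Finset.mem_image_of_mem _ (Finset.mem_univ i))))
      simpa using Submodule.sub_mem _ h1 (Submodule.smul_mem _ K hvT)
    rw [eq_top_iff]
    intro x _
    rw [pi_eq_sum_univ' x]
    exact Submodule.sum_mem _ fun i _ => Submodule.smul_mem _ _ (hei i)
  · exact hT s hs d₀ (Finset.mem_insert_self _ _) (by simp [h0])

theorem IsJacobiIndex.finite_neigh {N : ℕ} {L : Matrix (Fin N) (Fin N) ℤ}
    (hL : IsJacobiIndex L) (r : Fin N → ℤ) : (neigh L r).Finite :=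
  (hL.finite_setOf_dualNorm_le (dualNorm L r)).subset fun _ h => h.2.le

theorem det_ne_zero_of_gramPullback {N : ℕ} {L L' st : Matrix (Fin N) (Fin N) ℤ}
    (hL : IsJacobiIndex L) (h : L = gramPullback L' st) : st.det ≠ 0 := by
  intro h0
  apply hL.det_ne_zero
  rw [h, gramPullback, Matrix.det_mul, h0, mul_zero]

theorem exists_isOldformTestSet {N : ℕ} (hN : 0 < N) {L st : Matrix (Fin N) (Fin N) ℤ}
    (hL : IsJacobiIndex L) (hst : st.det ≠ 0) : ∃ S, IsOldformTestSet L st S := by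
  classical
  obtain ⟨R, hR⟩ := hL.exists_isMinimalRepSystem
  -- W = l st⁻¹ with l = det(st)²; the square makes l positive. For s = W s' one has sᵗ(r - r') =
  -- s'ᵗWᵗ(r - r'), so separation means that s' avoids the hyperplanes orthogonal to the finitely
  -- many vectors Wᵗ(r - r').
  let W : Matrix (Fin N) (Fin N) ℤ := st.det • st.adjugate
  have hinj : Function.Injective st.mulVec := Matrix.mulVec_injective_of_det_ne_zero hst
  have hW : ∀ v, st.mulVec (W.mulVec v) = (st.det ^ 2) • v := fun v => by
    rw [Matrix.mulVec_mulVec, Matrix.mul_smul, Matrix.mul_adjugate, smul_smul, ← sq,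
      Matrix.smul_mulVec, Matrix.one_mulVec]
  have hWs : ∀ s s', st.mulVec s = (st.det ^ 2) • s' ↔ s = W.mulVec s' := fun s s' => by
    rw [← hW]
    exact hinj.eq_iff
  have hWdet : (W.transpose).det ≠ 0 := by
    rw [Matrix.det_transpose]
    intro h0
    have h1 : (st * W).det = 0 := by rw [Matrix.det_mul, h0, mul_zero]
    rw [Matrix.mul_smul, Matrix.mul_adjugate, smul_smul, Matrix.det_smul, Matrix.det_one,
      mul_one] at h1
    exact pow_ne_zero _ (mul_ne_zero hst hst) h1
  let M : Set (Fin N → ℤ) := ⋃ r₀ ∈ R, (neigh L r₀ ∪ neigh L (-r₀))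
  have hM : M.Finite := R.finite_toSet.biUnion fun r₀ _ =>
    (hL.finite_neigh r₀).union (hL.finite_neigh (-r₀))
  have hT : ∀ r : Fin N → ℤ, ∃ T, IsStrongRestrictionSet L st (st.det ^ 2) R r T := by
    intro r
    obtain ⟨T, hspan, hne, hsep⟩ := exists_span_eq_top_forall_dotProduct_ne_zero hN
      ((hM.toFinset.erase r).image fun r' => (W.transpose).mulVec (r - r')) (by
        intro d hd h0
        obtain ⟨r', hr', rfl⟩ := Finset.mem_image.1 hd
        have := Matrix.eq_zero_of_mulVec_eq_zero hWdet h0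
        exact (Finset.mem_erase.1 hr').1 (sub_eq_zero.1 this).symm)
    refine ⟨T, hne, hspan, fun s' hs' s hs r₀ hr₀ r' hr' hdot => ?_⟩
    by_contra hrr
    refine hsep s' hs' _ (Finset.mem_image_of_mem _ (Finset.mem_erase.2
      ⟨fun h => hrr h.symm, hM.mem_toFinset.2 (Set.mem_biUnion hr₀ hr')⟩)) ?_
    rw [Matrix.mulVec_transpose, dotProduct_comm, ← Matrix.dotProduct_mulVec, ← (hWs s s').1 hs,
      dotProduct_comm, dotProduct_sub, hdot, sub_self]
  choose T hT using hT
  refine ⟨R.biUnion fun r => (T r).image W.mulVec, st.det ^ 2, R, T, by positivity,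
    fun v => ⟨_, hW v⟩, hR, fun r _ => hT r, fun s => ?_⟩
  simp only [Finset.mem_biUnion, Finset.mem_image, hWs]
  simp only [eq_comm]

/-! ### Support of the Fourier coefficients. -/

theorem integral_expTwoPiI_intCast_mul (j : ℤ) :
    ∫ x in (0 : ℝ)..1, expTwoPiI (j * x) = if j = 0 then 1 else 0 := by
  split_ifs with hj
  · simp [hj, expTwoPiI_zero]
  · have hc : (2 * Real.pi * Complex.I * j : ℂ) ≠ 0 :=
      mul_ne_zero Complex.two_pi_I_ne_zero (Int.cast_ne_zero.2 hj)
    have h := integral_exp_mul_complex (a := 0) (b := 1) hc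
    simp only [expTwoPiI, ← mul_assoc]
    rw [h]
    have h1 := expTwoPiI_intCast j
    rw [expTwoPiI] at h1
    simp [h1]

/-- Integration against e(-mx) isolates frequency m. Several r may share a frequency, so only the
grouped sums are known to vanish. -/
theorem sum_filter_eq_zero_of_expTwoPiI_sum_eq_zero {ι : Type*} (B : Finset ι) (a : ι → ℂ)
    (f : ι → ℤ) (h : ∀ x : ℝ, ∑ r ∈ B, a r * expTwoPiI (f r * x) = 0) (m : ℤ) :
    ∑ r ∈ B with f r = m, a r = 0 := by
  have h1 : ∫ x in (0 : ℝ)..1, ∑ r ∈ B, a r * expTwoPiI (((f r - m : ℤ) : ℂ) * x) = 0 := by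
    rw [intervalIntegral.integral_congr (g := fun _ => (0 : ℂ))]
    · simp
    · intro x _
      have h2 : ∀ r, expTwoPiI (((f r - m : ℤ) : ℂ) * x) =
          expTwoPiI (f r * x) * expTwoPiI (-m * x) := fun r => by
        rw [← expTwoPiI_add]
        push_cast
        ring_nf
      simp only [h2, ← mul_assoc]
      rw [← Finset.sum_mul, h, zero_mul]
  rw [intervalIntegral.integral_finsetSum] at h1
  · simp only [intervalIntegral.integral_const_mul, integral_expTwoPiI_intCast_mul, sub_eq_zero,
      mul_ite, mul_one, mul_zero] at h1
    rw [Finset.sum_filter]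
    exact h1
  · intro r _
    refine Continuous.intervalIntegrable ?_ _ _
    exact continuous_const.mul (continuous_expTwoPiI.comp (by fun_prop))

/-- Modulo 2 the off-diagonal terms cancel in pairs under (i,j) ↦ (j,i), and the diagonal terms are
even. -/
theorem IsJacobiIndex.even_dotProduct_mulVec {N : ℕ} {L : Matrix (Fin N) (Fin N) ℤ}
    (hL : IsJacobiIndex L) (lam : Fin N → ℤ) : Even (dotProduct lam (L.mulVec lam)) := by
  rw [even_iff_two_dvd, ← Nat.cast_ofNat, ← ZMod.intCast_zmod_eq_zero_iff_dvd]
  have hsum : dotProduct lam (L.mulVec lam) =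
      ∑ p : Fin N × Fin N, lam p.1 * (L p.1 p.2 * lam p.2) := by
    simp only [dotProduct, Matrix.mulVec, Finset.mul_sum, Fintype.sum_prod_type]
  rw [hsum, Int.cast_sum]
  refine Finset.sum_involution (fun p _ => p.swap) ?_ ?_ ?_ ?_
  · rintro ⟨i, j⟩ _
    have : lam j * (L j i * lam i) = lam i * (L i j * lam j) := by
      rw [hL.symm.apply i j]
      ring
    simp only [Prod.swap, this]
    exact CharTwo.add_self_eq_zero _
  · rintro ⟨i, j⟩ _ hne heq
    apply hne
    have hij : j = i := congrArg Prod.fst heq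
    subst hij
    obtain ⟨c, hc⟩ := hL.even j
    simp only [hc]
    push_cast
    rw [CharTwo.add_self_eq_zero, zero_mul, mul_zero]
  · simp
  · simp

/-- Every vector is a translate of a minimal one, up to sign of the representative. -/
theorem IsMinimalRepSystem.exists_eq_add_mulVec {N : ℕ} {L : Matrix (Fin N) (Fin N) ℤ}
    (hL : IsJacobiIndex L) {R : Finset (Fin N → ℤ)} (hR : IsMinimalRepSystem L R)
    (r : Fin N → ℤ) : ∃ r₀ ∈ R, ∃ q, (q = r₀ ∨ q = -r₀) ∧ ∃ (lam : Fin N → ℤ) (E : ℤ),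
      r = q + L.mulVec lam ∧ 2 * E = 2 * dotProduct q lam + dotProduct lam (L.mulVec lam) ∧
      0 ≤ E ∧ dualNorm L r = dualNorm L q + 2 * E := by
  obtain ⟨r₀, ⟨hr₀, lam, h⟩, -⟩ := hR.existsUnique r
  obtain ⟨q, hq, hrq, hle⟩ : ∃ q, (q = r₀ ∨ q = -r₀) ∧ r = q + L.mulVec lam ∧
      dualNorm L q ≤ dualNorm L r := by
    rcases h with h | h
    · exact ⟨r₀, Or.inl rfl, h, h ▸ hR.minimal r₀ hr₀ lam⟩
    · refine ⟨-r₀, Or.inr rfl, h, ?_⟩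
      have h1 := hR.minimal r₀ hr₀ (-lam)
      have h2 : r₀ + L.mulVec (-lam) = -r := by
        rw [h, Matrix.mulVec_neg]
        abel
      rwa [h2, dualNorm_neg, ← dualNorm_neg L r₀] at h1
  -- Evenness makes E an integer, so n - E is again an index of a Fourier coefficient.
  obtain ⟨c, hc⟩ := hL.even_dotProduct_mulVec lam
  have hE : 2 * (dotProduct q lam + c) = 2 * dotProduct q lam + dotProduct lam (L.mulVec lam) := by
    rw [hc]
    ring
  have hnorm : dualNorm L r = dualNorm L q + 2 * ((dotProduct q lam + c : ℤ) : ℚ) := by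
    rw [hrq, hL.dualNorm_add_mulVec, ← hE]
    push_cast
    ring
  refine ⟨r₀, hr₀, q, hq, lam, dotProduct q lam + c, hrq, hE, ?_, hnorm⟩
  have : (0 : ℚ) ≤ ((dotProduct q lam + c : ℤ) : ℚ) := by linarith
  exact_mod_cast this

/-- `r` pairs integrally with the lattice `st⁻¹ ℤ^N`, where `l ℤ^N ⊆ st ℤ^N`. -/
def PairsIntegrally {N : ℕ} (st : Matrix (Fin N) (Fin N) ℤ) (l : ℤ) (r : Fin N → ℤ) : Prop :=
  ∀ w v : Fin N → ℤ, st.mulVec w = l • v → l ∣ dotProduct w r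

theorem PairsIntegrally.neg {N : ℕ} {st : Matrix (Fin N) (Fin N) ℤ} {l : ℤ} {r : Fin N → ℤ}
    (h : PairsIntegrally st l r) : PairsIntegrally st l (-r) := fun w v hwv => by
  rw [dotProduct_neg]
  exact (h w v hwv).neg_right

/-- Integrality of L' enters here: wᵗLλ = (st w)ᵗL'(st λ) = l vᵗL'(st λ). -/
theorem PairsIntegrally.add_mulVec {N : ℕ} {L' st : Matrix (Fin N) (Fin N) ℤ} {l : ℤ}
    {r : Fin N → ℤ} (h : PairsIntegrally st l r) (lam : Fin N → ℤ) :
    PairsIntegrally st l (r + (gramPullback L' st).mulVec lam) := fun w v hwv => by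
  rw [dotProduct_add]
  refine (h w v hwv).add ?_
  rw [gramPullback, Matrix.mul_assoc, ← Matrix.mulVec_mulVec, Matrix.mulVec_transpose,
    dotProduct_comm, ← Matrix.dotProduct_mulVec, hwv, dotProduct_smul, smul_eq_mul]
  exact dvd_mul_right _ _

theorem dvd_contentOf {N : ℕ} {st : Matrix (Fin N) (Fin N) ℤ} {l : ℤ} {s s' : Fin N → ℤ}
    (h : st.mulVec s = l • s') : l ∣ contentOf st s := by
  refine Finset.dvd_gcd fun i _ => ?_
  rw [h]
  exact dvd_mul_right _ _

/-- Let g be the gcd of s' and s' = g v. Then l_s = l g and s = g w with st w = l v, so the factor l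
in wᵗr is supplemented by g. -/
theorem PairsIntegrally.contentOf_dvd {N : ℕ} {st : Matrix (Fin N) (Fin N) ℤ} {l : ℤ}
    {r : Fin N → ℤ} (hr : PairsIntegrally st l r) (hst : st.det ≠ 0) (hl : 0 < l)
    (hlw : ∀ v : Fin N → ℤ, ∃ w : Fin N → ℤ, st.mulVec w = l • v)
    {s s' : Fin N → ℤ} (hs : st.mulVec s = l • s') : contentOf st s ∣ dotProduct s r := by
  have hcontent : contentOf st s = l * Finset.univ.gcd s' := by
    rw [contentOf, hs]
    change Finset.univ.gcd (fun i => l * s' i) = _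
    rw [Finset.gcd_mul_left, Int.normalize_of_nonneg hl.le]
  have hdvd : ∀ i, Finset.univ.gcd s' ∣ s' i := fun i => Finset.gcd_dvd (Finset.mem_univ i)
  choose v hv using hdvd
  obtain ⟨w, hw⟩ := hlw v
  have hsw : s = Finset.univ.gcd s' • w := by
    apply Matrix.mulVec_injective_of_det_ne_zero hst
    rw [Matrix.mulVec_smul, hw, hs]
    ext i
    simp only [Pi.smul_apply, smul_eq_mul]
    rw [mul_left_comm, ← hv i]
  rw [hcontent, hsw, smul_dotProduct, smul_eq_mul, mul_comm l]
  exact mul_dvd_mul_left _ (hr w v hw)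

/-- Divisibility by l is additive in v, so if it held on T it would hold on the whole span. -/
theorem exists_not_dvd_of_not_pairsIntegrally {N : ℕ} {st : Matrix (Fin N) (Fin N) ℤ} {l : ℤ}
    {r : Fin N → ℤ} (hr : ¬ PairsIntegrally st l r) (hst : st.det ≠ 0)
    (hlw : ∀ v : Fin N → ℤ, ∃ w : Fin N → ℤ, st.mulVec w = l • v)
    {T : Finset (Fin N → ℤ)} (hT : Submodule.span ℤ (T : Set (Fin N → ℤ)) = ⊤) :
    ∃ s' ∈ T, ∃ s, st.mulVec s = l • s' ∧ ¬ l ∣ dotProduct s r := by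
  by_contra! hcon
  apply hr
  have hinj := Matrix.mulVec_injective_of_det_ne_zero hst
  have hall : ∀ v ∈ Submodule.span ℤ (T : Set (Fin N → ℤ)), ∀ w, st.mulVec w = l • v →
      l ∣ dotProduct w r := by
    intro v hv
    induction hv using Submodule.span_induction with
    | mem v hv => exact fun w hw => hcon v (Finset.mem_coe.1 hv) w hw
    | zero =>
      intro w hw
      have : w = 0 := hinj (by rw [hw, smul_zero, Matrix.mulVec_zero])
      simp [this]
    | add v₁ v₂ _ _ h₁ h₂ =>
      intro w hw
      obtain ⟨w₁, hw₁⟩ := hlw v₁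
      obtain ⟨w₂, hw₂⟩ := hlw v₂
      have : w = w₁ + w₂ := hinj (by rw [hw, Matrix.mulVec_add, hw₁, hw₂, smul_add])
      rw [this, add_dotProduct]
      exact (h₁ _ hw₁).add (h₂ _ hw₂)
    | smul a v _ h =>
      intro w hw
      obtain ⟨w₁, hw₁⟩ := hlw v
      have : w = a • w₁ := hinj (by rw [hw, Matrix.mulVec_smul, hw₁, smul_comm])
      rw [this, smul_dotProduct]
      exact (h _ hw₁).mul_left _
  intro w v hwv
  exact hall v (hT ▸ Submodule.mem_top) w hwv

namespace IsParabolicForm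

variable {N : ℕ} {k : ℤ} {L : Matrix (Fin N) (Fin N) ℤ} {Φ : ℂ → (Fin N → ℂ) → ℂ}

/-- For fixed `n`, only finitely many Fourier coefficients are nonzero. -/
theorem finite_support_jacobiFourierCoeff (h : IsParabolicForm k L Φ) (hL : IsJacobiIndex L)
    {R : Finset (Fin N → ℤ)} (hR : IsMinimalRepSystem L R) {y : ℝ} (hy : 0 < y) (n : ℤ) :
    {r | jacobiFourierCoeff Φ y n r ≠ 0}.Finite := by
  refine (R.finite_toSet.biUnion fun r₀ _ =>
    hL.finite_setOf_dualNorm_le (dualNorm L r₀ + 2 * n)).subset fun r hr => ?_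
  obtain ⟨r₀, hr₀, q, hq, lam, E, rfl, hE, -, hnorm⟩ := hR.exists_eq_add_mulVec hL r
  refine Set.mem_biUnion hr₀ ?_
  have h1 := h.jacobiFourierCoeff_add_mulVec hL.symm hy (n - E) E q lam hE
  rw [sub_add_cancel] at h1
  -- The coefficient equals the one at (n - E, q), so E ≤ n, which bounds the norm of r.
  have h2 : 0 ≤ n - E := by
    by_contra! hneg
    exact hr (h1.trans (h.jacobiFourierCoeff_eq_zero_of_neg hy hneg q))
  have h3 : (E : ℚ) ≤ n := by exact_mod_cast sub_nonneg.1 h2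
  have h4 : dualNorm L q = dualNorm L r₀ := by
    rcases hq with rfl | rfl
    · rfl
    · exact dualNorm_neg L r₀
  change dualNorm L _ ≤ _
  linarith

theorem intDot_toComplexVec_mul (r s : Fin N → ℤ) (x : ℝ) :
    intDot r (toComplexVec fun i => (s i : ℝ) * x) = ((dotProduct s r : ℤ) : ℂ) * x := by
  simp only [intDot, toComplexVec, dotProduct, Int.cast_sum, Finset.sum_mul, Int.cast_mul,
    Complex.ofReal_mul, Complex.ofReal_intCast]
  exact Finset.sum_congr rfl fun i _ => by ring

/-- If the restrictions of a form along a test set are invariant under the finer translations, its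
Fourier coefficients are supported on the dual lattice of `st⁻¹ ℤ^N`. -/
theorem jacobiFourierCoeff_eq_zero_of_not_pairsIntegrally (h : IsParabolicForm k L Φ)
    (hL : IsJacobiIndex L) {L' st : Matrix (Fin N) (Fin N) ℤ} (hLL' : L = gramPullback L' st)
    {R : Finset (Fin N → ℤ)} (hR : IsMinimalRepSystem L R) {l : ℤ} (hl : 0 < l)
    (hlw : ∀ v : Fin N → ℤ, ∃ w : Fin N → ℤ, st.mulVec w = l • v)
    {T : (Fin N → ℤ) → Finset (Fin N → ℤ)}
    (hT : ∀ r ∈ R, IsStrongRestrictionSet L st l R r (T r)) {y : ℝ} (hy : 0 < y)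
    (hinv : ∀ r ∈ R, ∀ s' ∈ T r, ∀ s, st.mulVec s = l • s' → ∀ (n : ℤ) (x : ℝ),
      fourierJacobiCoeff Φ y n (fun i => (s i : ℝ) * (x + 1 / (contentOf st s : ℝ))) =
        fourierJacobiCoeff Φ y n (fun i => (s i : ℝ) * x))
    {r : Fin N → ℤ} (hr : ¬ PairsIntegrally st l r) (n : ℤ) : jacobiFourierCoeff Φ y n r = 0 := by
  by_contra hne
  have hst : st.det ≠ 0 := det_ne_zero_of_gramPullback hL hLL'
  -- Minimal counterexample: the least n with a nonzero coefficient at a bad index.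
  obtain ⟨n, ⟨r₁, hr₁, hne₁⟩, hleast⟩ := Int.exists_least_of_bdd
    (P := fun n => ∃ r, ¬ PairsIntegrally st l r ∧ jacobiFourierCoeff Φ y n r ≠ 0)
    ⟨0, fun n hn => by
      obtain ⟨r, -, hr⟩ := hn
      by_contra! hneg
      exact hr (h.jacobiFourierCoeff_eq_zero_of_neg hy hneg r)⟩ ⟨n, r, hr, hne⟩
  have hmin : ∀ r, ¬ PairsIntegrally st l r → jacobiFourierCoeff Φ y n r ≠ 0 →
      ∃ r₀ ∈ R, ∃ q, (q = r₀ ∨ q = -r₀) ∧ r ∈ neigh L q ∧ ¬ PairsIntegrally st l q ∧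
        jacobiFourierCoeff Φ y n q ≠ 0 := by
    intro r hr hne
    obtain ⟨r₀, hr₀, q, hq, lam, E, hrq, hE, hE0, hnorm⟩ := hR.exists_eq_add_mulVec hL r
    have h1 := h.jacobiFourierCoeff_add_mulVec hL.symm hy (n - E) E q lam hE
    rw [sub_add_cancel, ← hrq] at h1
    have hqb : ¬ PairsIntegrally st l q := fun hq => hr (by
      rw [hrq, hLL']
      exact hq.add_mulVec lam)
    -- The representative q is bad with nonzero coefficient at level n - E, so leastness forces E =
    -- 0: r itself has minimal norm.
    have h2 := hleast (n - E) ⟨q, hqb, h1 ▸ hne⟩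
    have hE' : E = 0 := by linarith
    subst hE'
    rw [sub_zero] at h1
    exact ⟨r₀, hr₀, q, hq, ⟨⟨lam, hrq⟩, by simpa using hnorm⟩, hqb, h1 ▸ hne⟩
  obtain ⟨r₀, hr₀, q, hq, -, hqb, hqne⟩ := hmin r₁ hr₁ hne₁
  have hr₀b : ¬ PairsIntegrally st l r₀ ∧ jacobiFourierCoeff Φ y n r₀ ≠ 0 := by
    rcases hq with rfl | rfl
    · exact ⟨hqb, hqne⟩
    · refine ⟨fun h0 => hqb h0.neg, fun h0 => hqne ?_⟩
      rw [h.jacobiFourierCoeff_neg hy, h0, mul_zero]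
  obtain ⟨s', hs', s, hs, hndvd⟩ := exists_not_dvd_of_not_pairsIntegrally hr₀b.1 hst hlw
    (hT r₀ hr₀).span_eq_top
  have hcdvd : ¬ contentOf st s ∣ dotProduct s r₀ := fun h0 => hndvd ((dvd_contentOf hs).trans h0)
  have hc0 : (contentOf st s : ℂ) ≠ 0 := by
    rw [Int.cast_ne_zero]
    intro h0
    apply (hT r₀ hr₀).ne_zero s' hs'
    rw [contentOf, Finset.gcd_eq_zero_iff] at h0
    funext i
    have hi := h0 i (Finset.mem_univ i)
    rw [hs] at hi
    simpa [hl.ne'] using hi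
  let B := (h.finite_support_jacobiFourierCoeff hL hR hy n).toFinset
  have hB : ∀ r ∉ B, jacobiFourierCoeff Φ y n r = 0 := fun r hr => by
    by_contra h0
    exact hr ((Set.Finite.mem_toFinset _).2 h0)
  -- Replacing x by x + 1/l_s multiplies the term of r by e(sᵗr/l_s); the weight below is that
  -- factor minus 1.
  have hsum := sum_filter_eq_zero_of_expTwoPiI_sum_eq_zero B
    (fun r => jacobiFourierCoeff Φ y n r *
      (expTwoPiI (((dotProduct s r : ℤ) : ℂ) / contentOf st s) - 1))
    (fun r => dotProduct s r) (fun x => by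
      have h1 := hinv r₀ hr₀ s' hs' s hs n x
      rw [h.fourierJacobiCoeff_eq_sum hy n B hB, h.fourierJacobiCoeff_eq_sum hy n B hB,
        ← sub_eq_zero, ← Finset.sum_sub_distrib] at h1
      rw [← h1]
      refine Finset.sum_congr rfl fun r _ => ?_
      rw [intDot_toComplexVec_mul, intDot_toComplexVec_mul]
      push_cast
      rw [mul_add, expTwoPiI_add, mul_one_div]
      ring) (dotProduct s r₀)
  have hmem : r₀ ∈ B.filter fun r => dotProduct s r = dotProduct s r₀ :=
    Finset.mem_filter.2 ⟨(Set.Finite.mem_toFinset _).2 hr₀b.2, rfl⟩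
  rw [Finset.sum_eq_single_of_mem r₀ hmem] at hsum
  · refine (mul_ne_zero hr₀b.2 fun h0 => hcdvd ?_) hsum
    rw [sub_eq_zero, expTwoPiI, Complex.exp_eq_one_iff] at h0
    obtain ⟨m, hm⟩ := h0
    have h2 : ((dotProduct s r₀ : ℤ) : ℂ) / contentOf st s = m :=
      mul_left_cancel₀ Complex.two_pi_I_ne_zero (hm.trans (mul_comm _ _))
    rw [div_eq_iff hc0] at h2
    exact ⟨m, by rw [mul_comm]; exact_mod_cast h2⟩
  · intro r hr hrne
    obtain ⟨hrB, hdot⟩ := Finset.mem_filter.1 hr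
    have hrc : jacobiFourierCoeff Φ y n r ≠ 0 := (Set.Finite.mem_toFinset _).1 hrB
    exfalso
    -- A good r would give l_s ∣ sᵗr = sᵗr₀; a bad r is a minimal vector, and s separates it from
    -- r₀.
    by_cases hrb : PairsIntegrally st l r
    · exact hcdvd (hdot ▸ hrb.contentOf_dvd hst hl hlw hs)
    · obtain ⟨r₂, hr₂, q₂, hq₂, hneigh, -, -⟩ := hmin r hrb hrc
      refine hrne ((hT r₀ hr₀).separates s' hs' s hs r₂ hr₂ r ?_ hdot.symm).symm
      rcases hq₂ with rfl | rfl
      · exact Or.inl hneigh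
      · exact Or.inr hneigh

/-- A form whose Fourier coefficients are supported on the dual lattice of `st⁻¹ ℤ^N` is invariant
under translation by `st⁻¹ ℤ^N`. -/
theorem apply_add_of_pairsIntegrally (h : IsParabolicForm k L Φ) (hL : IsJacobiIndex L)
    {st : Matrix (Fin N) (Fin N) ℤ} {R : Finset (Fin N → ℤ)} (hR : IsMinimalRepSystem L R)
    {l : ℤ} (hl : 0 < l)
    (hsupp : ∀ y : ℝ, 0 < y → ∀ (n : ℤ) (r : Fin N → ℤ), ¬ PairsIntegrally st l r →
      jacobiFourierCoeff Φ y n r = 0)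
    {w v : Fin N → ℤ} (hwv : st.mulVec w = l • v) {t : ℂ} (ht : 0 < t.im) (z : Fin N → ℂ) :
    Φ t (z + fun i => (w i : ℂ) / l) = Φ t z := by
  have hμ : (fun i => (w i : ℂ) / l) = toComplexVec fun i => (w i : ℝ) * (1 / (l : ℝ)) := by
    ext i
    simp [toComplexVec, div_eq_mul_inv]
  rw [hμ]
  refine h.apply_add_toComplexVec (fun y hy n u => ?_) ht z
  let B := (h.finite_support_jacobiFourierCoeff hL hR hy n).toFinset
  have hB : ∀ r ∉ B, jacobiFourierCoeff Φ y n r = 0 := fun r hr => by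
    by_contra h0
    exact hr ((Set.Finite.mem_toFinset _).2 h0)
  rw [h.fourierJacobiCoeff_eq_sum hy n B hB, h.fourierJacobiCoeff_eq_sum hy n B hB]
  refine Finset.sum_congr rfl fun r _ => ?_
  by_cases hr : PairsIntegrally st l r
  · obtain ⟨c, hc⟩ := hr w v hwv
    have hl0 : (l : ℂ) ≠ 0 := Int.cast_ne_zero.2 hl.ne'
    have h1 : ((dotProduct w r : ℤ) : ℂ) * ((1 / (l : ℝ) : ℝ) : ℂ) = c := by
      rw [hc]
      push_cast
      field_simp
    rw [toComplexVec_add, intDot_add_right, intDot_toComplexVec_mul, h1, expTwoPiI_add_intCast]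
  · rw [hsupp y hy n r hr, zero_mul, zero_mul]

end IsParabolicForm

/-! ### Periodicity and descent to index L'. -/

section Bilin

variable {N : ℕ} (L : Matrix (Fin N) (Fin N) ℤ)

theorem bilin_add_left (x x' y : Fin N → ℂ) : bilin L (x + x') y = bilin L x y + bilin L x' y :=
  add_dotProduct _ _ _

theorem bilin_add_right (x y y' : Fin N → ℂ) : bilin L x (y + y') = bilin L x y + bilin L x y' := by
  simp only [bilin, Matrix.mulVec_add, dotProduct_add]

theorem bilin_smul_left (t : ℂ) (x y : Fin N → ℂ) : bilin L (t • x) y = t * bilin L x y :=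
  smul_dotProduct _ _ _

theorem bilin_smul_right (t : ℂ) (x y : Fin N → ℂ) : bilin L x (t • y) = t * bilin L x y := by
  simp only [bilin, Matrix.mulVec_smul, dotProduct_smul, smul_eq_mul]

theorem bilin_zero_left (y : Fin N → ℂ) : bilin L 0 y = 0 := zero_dotProduct _

theorem bilin_comm {L : Matrix (Fin N) (Fin N) ℤ} (hL : L.IsSymm) (x y : Fin N → ℂ) :
    bilin L x y = bilin L y x := by
  have h : (L.map (Int.cast : ℤ → ℂ)).IsSymm := by
    ext i j
    simp [hL.apply i j]
  rw [bilin, bilin, Matrix.dotProduct_mulVec, ← Matrix.mulVec_transpose, h.eq, dotProduct_comm]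

theorem bilin_gramPullback (st : Matrix (Fin N) (Fin N) ℤ) (x y : Fin N → ℂ) :
    bilin (gramPullback L st) x y = bilin L ((st.map (Int.cast : ℤ → ℂ)).mulVec x)
      ((st.map (Int.cast : ℤ → ℂ)).mulVec y) := by
  have h : (gramPullback L st).map (Int.cast : ℤ → ℂ) = (st.map (Int.cast : ℤ → ℂ)).transpose *
      (L.map (Int.cast : ℤ → ℂ) * st.map (Int.cast : ℤ → ℂ)) := by
    have h1 := Matrix.map_mul (L := st.transpose) (M := L * st) (f := Int.castRingHom ℂ)
    rw [Matrix.map_mul (L := L), ← Matrix.mul_assoc] at h1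
    exact h1
  rw [bilin, h, ← Matrix.mulVec_mulVec, Matrix.mulVec_transpose, dotProduct_comm,
    ← Matrix.dotProduct_mulVec, dotProduct_comm, ← Matrix.mulVec_mulVec, bilin]

end Bilin

namespace IsJacobiForm

variable {N : ℕ} {k : ℤ} {L : Matrix (Fin N) (Fin N) ℤ} {φ : ℍ × (Fin N → ℂ) → ℂ}

/-- The modular transformation law. -/
theorem modular (h : IsJacobiForm k L φ) (γ : SL(2, ℤ)) (τ : ℍ) (w : Fin N → ℂ) :
    (((γ 1 0 : ℤ) : ℂ) * τ + (γ 1 1 : ℤ)) ^ (-k) *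
      expTwoPiI (-((γ 1 0 : ℤ) : ℂ) * bilin L w w / (2 * (((γ 1 0 : ℤ) : ℂ) * τ + (γ 1 1 : ℤ)))) *
      φ (γ • τ, (((γ 1 0 : ℤ) : ℂ) * τ + (γ 1 1 : ℤ))⁻¹ • w) = φ (τ, w) := by
  have h1 := congrFun (h.slash_eq γ 0 0) (τ, w)
  rw [← h1]
  have h0 : (fun i : Fin N => (((0 : Fin N → ℤ) i : ℤ) : ℂ)) = 0 := by ext; simp
  have hw : (fun i : Fin N => w i + (((0 : Fin N → ℤ) i : ℤ) : ℂ) * (τ : ℂ) +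
      (((0 : Fin N → ℤ) i : ℤ) : ℂ)) = w := by ext; simp
  simp only [jacobiSlash, hw, h0, bilin_zero_left, mul_zero, zero_div, add_zero]
  congr 3
  ext i
  simp [div_eq_inv_mul]

theorem elliptic (h : IsJacobiForm k L φ) (τ : ℍ) (z : Fin N → ℂ) (lam mu : Fin N → ℤ) :
    expTwoPiI (τ * bilin L (fun i => (lam i : ℂ)) (fun i => (lam i : ℂ)) / 2 +
      bilin L (fun i => (lam i : ℂ)) z) * φ (τ, fun i => z i + lam i * τ + mu i) = φ (τ, z) := by
  have h1 := congrFun (h.slash_eq 1 lam mu) (τ, z)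
  simpa [jacobiSlash] using h1

/-- The Fourier analysis needs only T, -1, the elliptic transformations and the growth condition at
α = 0. -/
theorem isParabolicForm (h : IsJacobiForm k L φ) :
    IsParabolicForm k L fun t z => φ (UpperHalfPlane.ofComplex t, z) where
  holo := h.holo
  add_one t z ht := by
    have hT : UpperHalfPlane.ofComplex (t + 1) = ModularGroup.T • UpperHalfPlane.ofComplex t := by
      rw [UpperHalfPlane.modular_T_smul]
      ext1
      rw [UpperHalfPlane.coe_vadd, UpperHalfPlane.ofComplex_apply_of_im_pos ht,
        UpperHalfPlane.ofComplex_apply_of_im_pos (by simpa using ht)]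
      simp [add_comm]
    have h1 := h.modular ModularGroup.T (UpperHalfPlane.ofComplex t) z
    simpa [ModularGroup.T, hT, expTwoPiI_zero] using h1
  elliptic t z ht lam mu := by
    have h1 := h.elliptic (UpperHalfPlane.ofComplex t) z lam mu
    rwa [UpperHalfPlane.ofComplex_apply_of_im_pos ht] at h1 ⊢
  neg t z ht := by
    have h1 := h.modular (-1) (UpperHalfPlane.ofComplex t) (-z)
    have hsmul : (-1 : SL(2, ℤ)) • UpperHalfPlane.ofComplex t = UpperHalfPlane.ofComplex t := by
      rw [ModularGroup.SL_neg_smul, one_smul]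
    rw [hsmul] at h1
    rw [← h1]
    simp [expTwoPiI_zero, neg_smul, ← inv_zpow]
  bounded β := by
    obtain ⟨C, A, hC⟩ := UpperHalfPlane.isBoundedAtImInfty_iff.1 (h.growth 0 β)
    refine ⟨C, A, fun t hA ht => ?_⟩
    have h1 := hC (UpperHalfPlane.ofComplex t)
      (by rwa [UpperHalfPlane.ofComplex_apply_of_im_pos ht])
    have h0 : (fun i : Fin N => (((0 : Fin N → ℚ) i : ℚ) : ℂ)) = 0 := by ext; simp
    rw [h0] at h1
    simpa [bilin_zero_left, expTwoPiI_zero] using h1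

/-- A Jacobi form that is periodic with respect to a vector `v` transforms under the shift by
`τ v` as under an elliptic transformation. -/
theorem apply_add_smul_of_periodic (h : IsJacobiForm k L φ) (hL : L.IsSymm) {v : Fin N → ℂ}
    (hv : ∀ (τ : ℍ) (z : Fin N → ℂ), φ (τ, z + v) = φ (τ, z)) (τ : ℍ) (z : Fin N → ℂ) :
    expTwoPiI (τ * bilin L v v / 2 + bilin L v z) * φ (τ, z + (τ : ℂ) • v) = φ (τ, z) := by
  have hτ : (τ : ℂ) ≠ 0 := UpperHalfPlane.ne_zero τ
  -- Under the inversion the elliptic variable is divided by τ, so the shift by τv becomes the shift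
  -- by v.
  have hS : ∀ w : Fin N → ℂ, (τ : ℂ) ^ (-k) * expTwoPiI (-bilin L w w / (2 * τ)) *
      φ (ModularGroup.S • τ, (τ : ℂ)⁻¹ • w) = φ (τ, w) := fun w => by
    have := h.modular ModularGroup.S τ w
    simpa [ModularGroup.S] using this
  rw [← hS z, ← hS (z + (τ : ℂ) • v), smul_add, smul_smul, inv_mul_cancel₀ hτ, one_smul, hv]
  have key : expTwoPiI (τ * bilin L v v / 2 + bilin L v z) *
      expTwoPiI (-bilin L (z + (τ : ℂ) • v) (z + (τ : ℂ) • v) / (2 * τ)) =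
      expTwoPiI (-bilin L z z / (2 * τ)) := by
    rw [← expTwoPiI_add]
    congr 1
    simp only [bilin_add_left, bilin_add_right, bilin_smul_left, bilin_smul_right,
      bilin_comm hL z v]
    field_simp
    ring
  linear_combination (τ : ℂ) ^ (-k) * φ (ModularGroup.S • τ, (τ : ℂ)⁻¹ • z) * key

/-- Descent of a Jacobi form of index `L'[st]` that is invariant under `st⁻¹ ℤ^N`. -/
theorem mem_jacobiFormsU {L' st : Matrix (Fin N) (Fin N) ℤ}
    (h : IsJacobiForm k (gramPullback L' st) φ) (hL : (gramPullback L' st).IsSymm)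
    (hst : st.det ≠ 0)
    (hper : ∀ (τ : ℍ) (z : Fin N → ℂ) (m : Fin N → ℤ),
      φ (τ, z + (st.map (Int.cast : ℤ → ℂ))⁻¹.mulVec fun i => (m i : ℂ)) = φ (τ, z)) :
    φ ∈ jacobiFormsU k L' st := by
  set S := st.map (Int.cast : ℤ → ℂ) with hS
  have hdet : IsUnit S.det := by
    have h1 : S.det = (st.det : ℂ) := ((Int.castRingHom ℂ).map_det st).symm
    rw [h1, isUnit_iff_ne_zero]
    exact_mod_cast hst
  have hSA : ∀ x, S.mulVec (S⁻¹.mulVec x) = x := fun x => by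
    rw [Matrix.mulVec_mulVec, Matrix.mul_nonsing_inv _ hdet, Matrix.one_mulVec]
  have hAS : ∀ x, S⁻¹.mulVec (S.mulVec x) = x := fun x => by
    rw [Matrix.mulVec_mulVec, Matrix.nonsing_inv_mul _ hdet, Matrix.one_mulVec]
  have hbil : ∀ x y, bilin L' x y = bilin (gramPullback L' st) (S⁻¹.mulVec x) (S⁻¹.mulVec y) :=
    fun x y => by rw [bilin_gramPullback, ← hS, hSA, hSA]
  refine ⟨fun p => φ (p.1, S⁻¹.mulVec p.2), ⟨?_, ?_, ?_⟩, ?_⟩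
  · refine DifferentiableOn.comp (f := fun p : ℂ × (Fin N → ℂ) => (p.1, S⁻¹.mulVec p.2))
      h.holo ?_ fun p hp => hp
    refine Differentiable.differentiableOn (differentiable_fst.prodMk ?_)
    exact (Matrix.mulVecLin S⁻¹).toContinuousLinearMap.differentiable.comp differentiable_snd
  · intro γ lam mu
    ext ⟨τ, z⟩
    have hw : (fun i => z i + lam i * (τ : ℂ) + mu i) =
        z + (τ : ℂ) • (fun i => (lam i : ℂ)) + fun i => (mu i : ℂ) := by
      ext i
      simp [mul_comm]
    have hmod := h.modular γ τ (S⁻¹.mulVec (fun i => z i + lam i * (τ : ℂ) + mu i))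
    have hell := h.apply_add_smul_of_periodic hL (fun τ z => hper τ z lam) τ (S⁻¹.mulVec z)
    -- Periodicity, the derived elliptic law and the modular law combine to the full slash action
    -- with respect to L'.
    rw [← hper τ (_ + _) mu, ← Matrix.mulVec_smul, ← Matrix.mulVec_add, ← Matrix.mulVec_add,
      ← hw, ← hmod, ← Matrix.mulVec_smul, ← hbil, ← hbil, ← hbil] at hell
    rw [← hell]
    simp only [jacobiSlash]
    rw [add_assoc, expTwoPiI_add]
    have hdiv : (fun i => (z i + lam i * (τ : ℂ) + mu i) / (((γ 1 0 : ℤ) : ℂ) * τ + (γ 1 1 : ℤ))) =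
        (((γ 1 0 : ℤ) : ℂ) * τ + (γ 1 1 : ℤ))⁻¹ • fun i => z i + lam i * (τ : ℂ) + mu i := by
      ext i
      simp [div_eq_inv_mul]
    rw [hdiv]
    ring
  · intro α β
    set Q := st.map (Int.cast : ℤ → ℚ) with hQ
    have hQdet : IsUnit Q.det := by
      have h1 : Q.det = (st.det : ℚ) := ((Int.castRingHom ℚ).map_det st).symm
      rw [h1, isUnit_iff_ne_zero]
      exact_mod_cast hst
    -- The inverse of st preserves rational vectors, so the growth condition of φ at st⁻¹α, st⁻¹β
    -- applies.
    have hcast : ∀ a : Fin N → ℚ, S⁻¹.mulVec (fun i => (a i : ℂ)) =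
        fun i => ((Q⁻¹.mulVec a i : ℚ) : ℂ) := by
      intro a
      have h1 : Q.mulVec (Q⁻¹.mulVec a) = a := by
        rw [Matrix.mulVec_mulVec, Matrix.mul_nonsing_inv _ hQdet, Matrix.one_mulVec]
      have h2 : S.mulVec (fun i => ((Q⁻¹.mulVec a i : ℚ) : ℂ)) = fun i => (a i : ℂ) := by
        ext i
        rw [← congrFun h1 i]
        simp [Matrix.mulVec, dotProduct, hS, hQ]
      rw [← h2, hAS]
    have hg := h.growth (Q⁻¹.mulVec α) (Q⁻¹.mulVec β)
    have hfun : ∀ τ : ℍ, S⁻¹.mulVec (fun i => (α i : ℂ) * (τ : ℂ) + (β i : ℂ)) =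
        fun i => ((Q⁻¹.mulVec α i : ℚ) : ℂ) * (τ : ℂ) + ((Q⁻¹.mulVec β i : ℚ) : ℂ) := fun τ => by
      have h1 : (fun i => (α i : ℂ) * (τ : ℂ) + (β i : ℂ)) =
          (τ : ℂ) • (fun i => (α i : ℂ)) + fun i => (β i : ℂ) := by
        ext i
        simp [mul_comm]
      rw [h1, Matrix.mulVec_add, Matrix.mulVec_smul, hcast, hcast]
      ext i
      simp [mul_comm]
    simp only [hfun, hbil, hcast]
    exact hg
  · ext ⟨τ, z⟩
    simp only [jacobiPullback, ← hS, hAS]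

end IsJacobiForm

/-- A form ψ of scalar index has period 1, so ψ(τ, cx) has period 1/c in x; this is all that is used
of the hypothesis on φ[s]. -/
theorem jacobiPullback_colVec_add {N : ℕ} {k : ℤ} {φ : ℍ × (Fin N → ℂ) → ℂ} {s : Fin N → ℤ}
    {m : Matrix (Fin 1) (Fin 1) ℤ} {c : ℤ} (hc : c ≠ 0)
    (h : jacobiPullback φ (colVec s) ∈ jacobiFormsU k m !![c]) (τ : ℍ) (x : ℂ) :
    φ (τ, fun i => (s i : ℂ) * (x + 1 / c)) = φ (τ, fun i => (s i : ℂ) * x) := by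
  obtain ⟨ψ, hψ, hψφ⟩ := h
  have hc' : (c : ℂ) ≠ 0 := Int.cast_ne_zero.2 hc
  have h1 : ∀ x : ℂ, φ (τ, fun i => (s i : ℂ) * x) = ψ (τ, fun _ => c * x) := fun x => by
    have h2 := congrFun hψφ (τ, fun _ => x)
    simp only [jacobiPullback] at h2
    have h3 : ((colVec s).map (Int.cast : ℤ → ℂ)).mulVec (fun _ => x) =
        fun i => (s i : ℂ) * x := by
      ext i
      simp [Matrix.mulVec, dotProduct, colVec]
    have h4 : ((!![c] : Matrix (Fin 1) (Fin 1) ℤ).map (Int.cast : ℤ → ℂ)).mulVec (fun _ => x) =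
        fun _ => (c : ℂ) * x := by
      ext i
      fin_cases i
      simp [Matrix.mulVec, dotProduct]
    rw [h3, h4] at h2
    exact h2.symm
  have hell := IsJacobiForm.elliptic hψ τ (fun _ => c * x) 0 1
  have h0 : (fun i : Fin 1 => (((0 : Fin 1 → ℤ) i : ℤ) : ℂ)) = 0 := by ext; simp
  rw [h0] at hell
  simp only [bilin_zero_left, mul_zero, zero_div, add_zero, expTwoPiI_zero, one_mul,
    Pi.zero_apply, Pi.one_apply, Int.cast_zero, zero_mul, Int.cast_one] at hell
  rw [h1, h1, ← hell]
  congr 2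
  ext
  field_simp

theorem mainTheorem5 {N : ℕ} (hN : 0 < N) (L L' st : Matrix (Fin N) (Fin N) ℤ)
    (hL : IsJacobiIndex L) (hL' : ∀ i, Even (L' i i)) (hLL' : L = gramPullback L' st) :
    (∃ S : Finset (Fin N → ℤ), IsOldformTestSet L st S) ∧
    ∀ S : Finset (Fin N → ℤ), IsOldformTestSet L st S →
      ∀ (k : ℤ) (φ : UpperHalfPlane × (Fin N → ℂ) → ℂ), φ ∈ jacobiForms k L → φ ≠ 0 →
        (∀ s ∈ S, jacobiPullback φ (colVec s) ∈
          jacobiFormsU k (scalarIndex L st s) !![contentOf st s]) →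
        φ ∈ jacobiFormsU k L' st := by
  have hst : st.det ≠ 0 := det_ne_zero_of_gramPullback hL hLL'
  refine ⟨exists_isOldformTestSet hN hL hst, fun S hS k φ hφ _ hres => ?_⟩
  have hcontent := fun s (hs : s ∈ S) => hS.contentOf_ne_zero hs
  obtain ⟨l, R, T, hl, hlw, hR, hT, hmem⟩ := hS
  have hpar := IsJacobiForm.isParabolicForm hφ
  have hsupp : ∀ y : ℝ, 0 < y → ∀ (n : ℤ) (r : Fin N → ℤ), ¬ PairsIntegrally st l r →
      jacobiFourierCoeff (fun t z => φ (UpperHalfPlane.ofComplex t, z)) y n r = 0 := by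
    intro y hy n r hr
    refine hpar.jacobiFourierCoeff_eq_zero_of_not_pairsIntegrally hL hLL' hR hl hlw hT hy ?_ hr n
    intro r hr s' hs' s hs n x
    have hsS : s ∈ S := (hmem s).2 ⟨r, hr, s', hs', hs⟩
    unfold fourierJacobiCoeff
    congr 1
    ext x'
    congr 1
    have hvec : ∀ x : ℝ, toComplexVec (fun i => (s i : ℝ) * x) = fun i => (s i : ℂ) * x :=
      fun x => by ext i; simp [toComplexVec]
    rw [hvec, hvec]
    have := jacobiPullback_colVec_add (hcontent s hsS) (hres s hsS)
      (UpperHalfPlane.ofComplex (x' + y * Complex.I)) x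
    simpa using this
  subst hLL'
  refine IsJacobiForm.mem_jacobiFormsU hφ hL.symm hst fun τ z m => ?_
  obtain ⟨w, hw⟩ := hlw m
  have hdet : IsUnit (st.map (Int.cast : ℤ → ℂ)).det := by
    have h1 : (st.map (Int.cast : ℤ → ℂ)).det = (st.det : ℂ) :=
      ((Int.castRingHom ℂ).map_det st).symm
    rw [h1, isUnit_iff_ne_zero]
    exact_mod_cast hst
  have hl0 : (l : ℂ) ≠ 0 := Int.cast_ne_zero.2 hl.ne'
  -- With st w = l m one has st⁻¹m = w/l, the form in which the translation was treated.
  have hm : (fun i => (m i : ℂ)) =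
      (st.map (Int.cast : ℤ → ℂ)).mulVec fun i => (w i : ℂ) / l := by
    ext i
    have h1 : ((st.mulVec w i : ℤ) : ℂ) = l * m i := by
      rw [hw]
      simp
    rw [eq_comm, ← mul_right_inj' hl0, ← h1]
    simp only [Matrix.mulVec, dotProduct, Matrix.map_apply, Finset.mul_sum, Int.cast_sum,
      Int.cast_mul]
    refine Finset.sum_congr rfl fun j _ => ?_
    field_simp
  rw [hm, Matrix.mulVec_mulVec, Matrix.nonsing_inv_mul _ hdet, Matrix.one_mulVec]
  have := hpar.apply_add_of_pairsIntegrally hL hR hl hsupp hw τ.im_pos z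
  simpa using this
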